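/- Let $\mathbb T^2=\mathbb R^2/\mathbb Z^2$, let $\varepsilon>0$ and $a,b,c\in\mathbb R$, let $v\in L^\infty([0,\infty);W^{1,\infty}(\mathbb T^2;\mathbb R^2))$ be a divergence free flow, and let $u_0\in H^2(\mathbb T^2)$ be real-valued. Here $\|f\|_{H^s}^2=\sum_{k\in\mathbb Z^2}(1+|k|^2)^s|\hat f(k)|^2$, and $e^{-\tau\Delta^2}$ ($\tau\ge 0$) is the semigroup generated by the bi-Laplacian, i.e. it multiplies the $k$-th Fourier coefficient by $e^{-\tau(4\pi^2|k|^2)^2}$. For $T>0$, a *mild solution on $[0,T]$ with initial data $u_0$* of $$u_t+v\cdot\nabla u+\varepsilon\Delta^2u=\Delta(au^3+bu^2+cu)\quad\text{on }\mathbb T^2$$ is a real-valued function $u\in C([0,T];H^2(\mathbb T^2))\cap L^2((0,T];H^4(\mathbb T^2))$ such that for every $0\le t\le T$ $$u(t)=e^{-t\varepsilon\Delta^2}u_0+\int_0^te^{-(t-s)\varepsilon\Delta^2}\Delta\big(au^3+bu^2+cu\big)(s)\,ds-\int_0^te^{-(t-s)\varepsilon\Delta^2}\big(v\cdot\nabla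 u\big)(s)\,ds,$$ where the integrals are Bochner integrals with values in $H^2(\mathbb T^2)$. Let $$\tilde T=\sup\{T>0:\text{ there is a mild solution on }[0,T]\text{ with initial data }u_0\}\in[0,\infty]$$ be the maximal time of existence, and let $u:[0,\tilde T)\to H^2(\mathbb T^2)$ be the mild solution, i.e. $u$ restricted to $[0,T]$ is a mild solution on $[0,T]$ with initial data $u_0$ for every $0<T<\tilde T$. Then $\tilde T>0$, and either $\tilde T=\infty$ or $$\limsup_{t\to\tilde T^-}\|u(t)\|_{H^2}=\infty .$$ -/

import Mathlib

open MeasureTheory Set Filter Topology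
open scoped ENNReal NNReal

-- Mathlib's Haar probability measure on `ℝ / ℤ`, as used for its multi-variable Fourier series.
attribute [local instance] instMeasureSpaceUnitAddCircle

noncomputable section

namespace CahnHilliard

/-- The two-dimensional torus `ℝ² / ℤ²`. -/
abbrev Torus : Type := UnitAddTorus (Fin 2)

/-- The frequency lattice `ℤ²`. -/
abbrev Freq : Type := Fin 2 → ℤ

/-- The space `L²(𝕋²; ℂ)`; real-valued functions are singled out by `IsRealValued`. -/
abbrev L2 : Type := Lp ℂ 2 (volume : Measure Torus)

/-- `f` takes real values almost everywhere. -/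
def IsRealValued (f : L2) : Prop := ∀ᵐ x : Torus, (f x).im = 0

/-- `|k|² = k₁² + k₂²`. -/
def freqSq (k : Freq) : ℝ := ∑ i, (k i : ℝ) ^ 2

/-- The norm of the inhomogeneous Sobolev space `H^s(𝕋²)`:
`‖f‖² = ∑ₖ (1 + |k|²)^s |f̂(k)|²`, with value `∞` when `f ∉ H^s`. -/
def sobolevNorm (s : ℝ) (f : L2) : ℝ≥0∞ :=
  (∑' k : Freq, ENNReal.ofReal ((1 + freqSq k) ^ s) *
    ‖UnitAddTorus.mFourierCoeff (f : Torus → ℂ) k‖ₑ ^ 2) ^ (1 / 2 : ℝ)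

/-- `f ∈ H^s(𝕋²)`. -/
def MemSobolev (s : ℝ) (f : L2) : Prop := sobolevNorm s f < ∞

open Classical in
/-- The Fourier multiplier with symbol `m`: the `L²` function with Fourier coefficients
`m k * f̂(k)`, if these are square summable (and `0` by convention otherwise). -/
def fourierMultiplier (m : Freq → ℂ) (f : Torus → ℂ) : L2 :=
  if h : Memℓp (fun k => m k * UnitAddTorus.mFourierCoeff f k) 2 then
    (UnitAddTorus.mFourierBasis (d := Fin 2)).repr.symm ⟨fun k => m k * UnitAddTorus.mFourierCoeff f k, h⟩
  else 0

/-- The partial derivative `∂ⱼ f`, with symbol `2πi kⱼ`. -/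
def partialDeriv (j : Fin 2) (f : Torus → ℂ) : L2 :=
  fourierMultiplier (fun k => 2 * Real.pi * Complex.I * (k j : ℂ)) f

/-- The Laplacian `Δ f`, with symbol `-4π²|k|²`. -/
def laplacian (f : Torus → ℂ) : L2 :=
  fourierMultiplier (fun k => ((-(4 * Real.pi ^ 2 * freqSq k) : ℝ) : ℂ)) f

/-- The semigroup `e^{-τΔ²}` generated by the bi-Laplacian, with symbol `e^{-τ(4π²|k|²)²}`. -/
def biheat (τ : ℝ) (f : Torus → ℂ) : L2 :=
  fourierMultiplier (fun k => ((Real.exp (-(τ * (4 * Real.pi ^ 2 * freqSq k) ^ 2)) : ℝ) : ℂ)) f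

/-- A divergence free flow `v ∈ L^∞([0,∞); W^{1,∞}(𝕋²; ℝ²))`; `v t i` is the `i`-th component of
the velocity field at time `t`. Measurability in time is required only for `v` as a map with values
in `L²`, which is weaker than strong measurability as a map with values in `W^{1,∞}`. -/
structure IsDivFreeFlow (v : ℝ → Fin 2 → L2) : Prop where
  aestronglyMeasurable : ∀ i, AEStronglyMeasurable (fun t => v t i) (volume.restrict (Ici 0))
  isRealValued : ∀ᵐ t ∂(volume.restrict (Ici (0 : ℝ))), ∀ i, IsRealValued (v t i)
  bounded : ∃ M : ℝ≥0, ∀ᵐ t ∂(volume.restrict (Ici (0 : ℝ))), ∀ i,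
    eLpNorm (v t i) ∞ volume ≤ M ∧ MemSobolev 1 (v t i) ∧
      ∀ j, eLpNorm (partialDeriv j (v t i)) ∞ volume ≤ M
  divFree : ∀ᵐ t ∂(volume.restrict (Ici (0 : ℝ))), ∑ i, partialDeriv i (v t i) = 0

/-- The nonlinear term `Δ(a f³ + b f² + c f)`. -/
def nonlinearTerm (a b c : ℝ) (f : L2) : L2 :=
  laplacian (fun x => a * f x ^ 3 + b * f x ^ 2 + c * f x)

/-- The advection term `w · ∇f`, as a function on the torus. -/
def advection (w : Fin 2 → L2) (f : L2) : Torus → ℂ :=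
  fun x => ∑ i, w i x * partialDeriv i f x

/-- `g : ℝ → L²` is Bochner integrable over `(0, t)` as a function with values in `H²`.
(As `H²` is a separable Hilbert space continuously embedded in `L²`, it suffices to ask for strong
measurability in `L²` and integrability of the `H²` norm; the integral can be computed in `L²`.) -/
def BochnerIntegrableH2 (g : ℝ → L2) (t : ℝ) : Prop :=
  IntervalIntegrable g volume 0 t ∧ ∫⁻ s in Ioo 0 t, sobolevNorm 2 (g s) < ∞

/-- `u` is a mild solution on `[0, T]` with initial data `u₀` of
`∂ₜu + v · ∇u + ε Δ²u = Δ(a u³ + b u² + c u)`. Only the values of `u` on `[0, T]` matter. -/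
structure IsMildSolution (ε a b c : ℝ) (v : ℝ → Fin 2 → L2) (u₀ : L2) (T : ℝ) (u : ℝ → L2) :
    Prop where
  isRealValued : ∀ t ∈ Icc 0 T, IsRealValued (u t)
  /-- `u` takes values in `H²` on `[0, T]`. -/
  memSobolev : ∀ t ∈ Icc 0 T, MemSobolev 2 (u t)
  /-- `u : [0, T] → H²` is continuous. -/
  continuous : ∀ t ∈ Icc 0 T,
    Tendsto (fun r => sobolevNorm 2 (u r - u t)) (𝓝[Icc 0 T] t) (𝓝 0)
  /-- `u ∈ L²((0, T]; H⁴)`. -/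
  sqIntegrable : ∫⁻ t in Ioc 0 T, sobolevNorm 4 (u t) ^ 2 < ∞
  integrable_nonlinear : ∀ t ∈ Icc 0 T,
    BochnerIntegrableH2 (fun s => biheat ((t - s) * ε) (nonlinearTerm a b c (u s))) t
  integrable_advection : ∀ t ∈ Icc 0 T,
    BochnerIntegrableH2 (fun s => biheat ((t - s) * ε) (advection (v s) (u s))) t
  duhamel : ∀ t ∈ Icc 0 T,
    u t = biheat (t * ε) u₀
      + (∫ s in (0 : ℝ)..t, biheat ((t - s) * ε) (nonlinearTerm a b c (u s)))
      - ∫ s in (0 : ℝ)..t, biheat ((t - s) * ε) (advection (v s) (u s))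

/-- The maximal time of existence `T̃ ∈ [0, ∞]`: the supremum of all `T > 0` such that there is a
mild solution on `[0, T]` with initial data `u₀`. -/
def maximalTime (ε a b c : ℝ) (v : ℝ → Fin 2 → L2) (u₀ : L2) : ℝ≥0∞ :=
  sSup {τ | ∃ T : ℝ, 0 < T ∧ τ = ENNReal.ofReal T ∧ ∃ u, IsMildSolution ε a b c v u₀ T u}

end CahnHilliard

end

noncomputable section

namespace CahnHilliard

open UnitAddTorus

/-! The potential `bessel`, with symbol (1 + |k|²)⁻¹, is an isometry of L² onto H², so an H²-valued
path u is written as `bessel p` with p a path in L², and Duhamel's formula is checked on each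
Fourier coefficient.

In two dimensions ∑ (1 + |k|²)⁻² converges. Hence H² functions have absolutely summable Fourier
coefficients, H² is a Banach algebra (`besselMulCLM`), and Δ(au³ + bu² + cu) is locally Lipschitz
from H² to L² (`nonlinearL2_lipschitz`). The advection term is Lipschitz from H² to L² with a
constant given by the L^∞ bound on v, uniformly for almost every time. The forcing thus loses two
derivatives, and the semigroup returns them at the price of a singularity: (1 + |k|²)
e^{-σ(4π²|k|²)²} ≲ σ^(-1/2) (`weight_mul_decay_le`). This is integrable in time, so Banach's fixed
point theorem (`exists_local_solution`) solves the equation on an interval whose length h depends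
only on a bound R for the H² norm of the data, not on the starting time.

Membership in L²(0, T; H⁴) is then automatic: frequency by frequency, Young's inequality in time and
the bound (1 + |k|²)² ∫ e^{-τε(4π²|k|²)²} dτ ≲ 1 gain four derivatives
(`lintegral_sobolevNorm_four_lt_top`).

Local existence from time 0 gives a positive maximal time τ. If τ and the limsup were both finite,
some t₁ within h of τ would have ‖u(t₁)‖ < R in H². Gluing the local solution started at t₁ to u
(`IsFourierSolution.extend`) gives a mild solution reaching past τ, against the definition of τ as a
supremum. Since that supremum asks only for existence, uniqueness plays no role. -/

instance isProbabilityMeasure_unitAddCircle :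
    IsProbabilityMeasure (volume : Measure UnitAddCircle) :=
  inferInstanceAs (IsProbabilityMeasure AddCircle.haarAddCircle)

/-! ### Fourier coefficients -/

lemma mFourierCoeff_congr_ae {f g : Torus → ℂ} (h : f =ᵐ[volume] g) (k : Freq) :
    mFourierCoeff f k = mFourierCoeff g k :=
  integral_congr_ae (h.mono fun x hx => by simp [hx])

/-- The `k`-th Fourier coefficient as a continuous linear functional on `L²`. -/
def coeffCLM (k : Freq) : L2 →L[ℂ] ℂ := innerSL ℂ (mFourierBasis (d := Fin 2) k)

lemma coeffCLM_apply (k : Freq) (f : L2) : coeffCLM k f = mFourierCoeff (f : Torus → ℂ) k := by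
  rw [coeffCLM, innerSL_apply_apply, ← mFourierBasis_repr, HilbertBasis.repr_apply_apply]

lemma ext_coeff {f g : L2} (h : ∀ k, coeffCLM k f = coeffCLM k g) : f = g := by
  apply (mFourierBasis (d := Fin 2)).repr.injective
  ext k
  simpa only [coeffCLM_apply, mFourierBasis_repr] using h k

lemma hasSum_norm_sq_coeff (f : L2) : HasSum (fun k => ‖coeffCLM k f‖ ^ 2) (‖f‖ ^ 2) := by
  have h := lp.hasSum_norm (p := 2) (by simp) ((mFourierBasis (d := Fin 2)).repr f)
  simpa [coeffCLM_apply, mFourierBasis_repr] using h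

lemma tsum_enorm_sq_coeff (f : L2) : ∑' k, ‖coeffCLM k f‖ₑ ^ 2 = ‖f‖ₑ ^ 2 := by
  have h := hasSum_norm_sq_coeff f
  have h2 := ENNReal.ofReal_tsum_of_nonneg (fun k => by positivity) h.summable
  rw [h.tsum_eq, ENNReal.ofReal_pow (norm_nonneg _), ofReal_norm] at h2
  rw [h2]
  exact tsum_congr fun k => by rw [ENNReal.ofReal_pow (norm_nonneg _), ofReal_norm]

lemma norm_coeffCLM_le (k : Freq) (f : L2) : ‖coeffCLM k f‖ ≤ ‖f‖ := by
  refine (pow_le_pow_iff_left₀ (norm_nonneg _) (norm_nonneg _) two_ne_zero).1 ?_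
  have h := hasSum_norm_sq_coeff f
  rw [← h.tsum_eq]
  exact h.summable.le_tsum k fun _ _ => by positivity

lemma memℓp_two_of_tsum_lt_top {a : Freq → ℂ} (h : ∑' k, ‖a k‖ₑ ^ 2 < ∞) : Memℓp a 2 := by
  apply memℓp_gen
  have : Summable fun k => (‖a k‖ₑ ^ 2).toReal := ENNReal.summable_toReal h.ne
  simpa using this

/-- The `L²` function with prescribed Fourier coefficients. -/
def ofCoeff (a : Freq → ℂ) (h : Memℓp a 2) : L2 := (mFourierBasis (d := Fin 2)).repr.symm ⟨a, h⟩

lemma coeff_ofCoeff (a : Freq → ℂ) (h : Memℓp a 2) (k : Freq) : coeffCLM k (ofCoeff a h) = a k := by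
  rw [coeffCLM_apply, ← mFourierBasis_repr, ofCoeff, LinearIsometryEquiv.apply_symm_apply]

lemma coeff_fourierMultiplier {m : Freq → ℂ} {f : Torus → ℂ}
    (h : Memℓp (fun k => m k * mFourierCoeff f k) 2) (k : Freq) :
    coeffCLM k (fourierMultiplier m f) = m k * mFourierCoeff f k := by
  rw [fourierMultiplier, dif_pos h]
  exact coeff_ofCoeff _ h k

lemma tsum_mul_coeff_le {m : Freq → ℂ} {C : ℝ} (hm : ∀ k, ‖m k‖ ≤ C) (f : L2) :
    ∑' k, ‖m k * coeffCLM k f‖ₑ ^ 2 ≤ (ENNReal.ofReal C * ‖f‖ₑ) ^ 2 := by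
  rw [mul_pow, ← tsum_enorm_sq_coeff, ← ENNReal.tsum_mul_left]
  gcongr with k
  rw [enorm_mul, mul_pow]
  gcongr
  rw [← ofReal_norm]
  exact ENNReal.ofReal_le_ofReal (hm k)

lemma memℓp_mul_coeff {m : Freq → ℂ} {C : ℝ} (hm : ∀ k, ‖m k‖ ≤ C) (f : L2) :
    Memℓp (fun k => m k * mFourierCoeff (f : Torus → ℂ) k) 2 := by
  simp_rw [← coeffCLM_apply]
  refine memℓp_two_of_tsum_lt_top ((tsum_mul_coeff_le hm f).trans_lt ?_)
  exact ENNReal.pow_lt_top (ENNReal.mul_lt_top ENNReal.ofReal_lt_top enorm_lt_top)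

lemma coeff_fourierMultiplier_of_bound {m : Freq → ℂ} {C : ℝ} (hm : ∀ k, ‖m k‖ ≤ C) (f : L2)
    (k : Freq) : coeffCLM k (fourierMultiplier m f) = m k * coeffCLM k f := by
  rw [coeff_fourierMultiplier (memℓp_mul_coeff hm f), coeffCLM_apply]

lemma enorm_fourierMultiplier_le {m : Freq → ℂ} {C : ℝ} (hm : ∀ k, ‖m k‖ ≤ C) (f : L2) :
    ‖fourierMultiplier m f‖ₑ ≤ ENNReal.ofReal C * ‖f‖ₑ := by
  rw [← ENNReal.pow_le_pow_left_iff two_ne_zero, ← tsum_enorm_sq_coeff]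
  simp_rw [coeff_fourierMultiplier_of_bound hm f]
  exact tsum_mul_coeff_le hm f

lemma norm_fourierMultiplier_le {m : Freq → ℂ} {C : ℝ} (hm : ∀ k, ‖m k‖ ≤ C) (f : L2) :
    ‖fourierMultiplier m f‖ ≤ C * ‖f‖ := by
  have hC : 0 ≤ C := (norm_nonneg _).trans (hm 0)
  have h := enorm_fourierMultiplier_le hm f
  rw [← ofReal_norm, ← ofReal_norm, ← ENNReal.ofReal_mul hC] at h
  exact (ENNReal.ofReal_le_ofReal_iff (by positivity)).1 h

/-- A bounded Fourier multiplier as a continuous linear map on `L²`. -/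
def multCLM (m : Freq → ℂ) (hm : ∃ C : ℝ, ∀ k, ‖m k‖ ≤ C) : L2 →L[ℂ] L2 :=
  LinearMap.mkContinuousOfExistsBound
    { toFun := fun f => fourierMultiplier m f
      map_add' := fun f g => ext_coeff fun k => by
        obtain ⟨C, hC⟩ := hm
        simp only [map_add, coeff_fourierMultiplier_of_bound hC, mul_add]
      map_smul' := fun r f => ext_coeff fun k => by
        obtain ⟨C, hC⟩ := hm
        simp only [map_smul, coeff_fourierMultiplier_of_bound hC, RingHom.id_apply, smul_eq_mul]
        ring }
    (hm.imp fun _ hC f => norm_fourierMultiplier_le hC f)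

lemma multCLM_apply {m : Freq → ℂ} (hm : ∃ C : ℝ, ∀ k, ‖m k‖ ≤ C) (f : L2) :
    multCLM m hm f = fourierMultiplier m f := rfl

lemma coeff_multCLM {m : Freq → ℂ} (hm : ∃ C : ℝ, ∀ k, ‖m k‖ ≤ C) (f : L2) (k : Freq) :
    coeffCLM k (multCLM m hm f) = m k * coeffCLM k f := by
  obtain ⟨C, hC⟩ := hm
  exact coeff_fourierMultiplier_of_bound hC f k

lemma fourierMultiplier_congr_ae (m : Freq → ℂ) {f g : Torus → ℂ} (h : f =ᵐ[volume] g) :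
    fourierMultiplier m f = fourierMultiplier m g := by
  have : mFourierCoeff f = mFourierCoeff g := funext fun k => mFourierCoeff_congr_ae h k
  unfold fourierMultiplier
  rw [this]

/-- Measurability of an `L²`-valued map can be tested on Fourier coefficients. -/
lemma aestronglyMeasurable_of_coeff {α : Type*} [MeasurableSpace α] {μ : Measure α} {f : α → L2}
    (h : ∀ k, AEStronglyMeasurable (fun s => coeffCLM k (f s)) μ) : AEStronglyMeasurable f μ := by
  refine aestronglyMeasurable_of_tendsto_ae (u := (atTop : Filter (Finset Freq)))
    (f := fun S s => ∑ k ∈ S, coeffCLM k (f s) • mFourierBasis (d := Fin 2) k) (fun S => ?_) ?_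
  · exact Finset.aestronglyMeasurable_fun_sum _ fun k _ => (h k).smul_const _
  · refine .of_forall fun s => ?_
    have := (mFourierBasis (d := Fin 2)).hasSum_repr (f s)
    simp only [mFourierBasis_repr, ← coeffCLM_apply] at this
    exact this

/-- Dominated convergence for the coefficients of `L²` functions. -/
lemma tendsto_of_coeff {α : Type*} {l : Filter α} {f : α → L2} {g : L2} (C : ℝ) (h : L2)
    (hb : ∀ᶠ x in l, ∀ k, ‖coeffCLM k (f x) - coeffCLM k g‖ ≤ C * ‖coeffCLM k h‖)
    (hc : ∀ k, Tendsto (fun x => coeffCLM k (f x)) l (𝓝 (coeffCLM k g))) :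
    Tendsto f l (𝓝 g) := by
  rw [tendsto_iff_norm_sub_tendsto_zero]
  have h2 : Tendsto (fun x => ‖f x - g‖ ^ 2) l (𝓝 0) := by
    simp_rw [fun x => ((hasSum_norm_sq_coeff (f x - g)).tsum_eq).symm]
    have := tendsto_tsum_of_dominated_convergence (𝓕 := l)
      (f := fun x k => ‖coeffCLM k (f x - g)‖ ^ 2) (g := fun _ => (0 : ℝ))
      (bound := fun k => C ^ 2 * ‖coeffCLM k h‖ ^ 2)
      ((hasSum_norm_sq_coeff h).summable.mul_left _) ?_ ?_
    · simpa using this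
    · intro k
      have := (hc k).sub_const (coeffCLM k g)
      simpa using this.norm.pow 2
    · filter_upwards [hb] with x hx k
      rw [map_sub, Real.norm_of_nonneg (by positivity), ← mul_pow]
      exact pow_le_pow_left₀ (norm_nonneg _) (hx k) 2
  have := h2.sqrt
  simpa using this

/-! ### Real-valued functions -/

lemma mFourierCoeff_neg_of_real {f : Torus → ℂ} (hf : ∀ᵐ x : Torus, (f x).im = 0) (k : Freq) :
    mFourierCoeff f (-k) = starRingEnd ℂ (mFourierCoeff f k) := by
  rw [mFourierCoeff, mFourierCoeff, ← integral_conj]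
  refine integral_congr_ae (hf.mono fun x hx => ?_)
  simp only [smul_eq_mul, map_mul, neg_neg, mFourier_neg, RCLike.conj_conj]
  rw [Complex.conj_eq_iff_im.2 hx]

/-- The symmetry says that f and its conjugate have the same coefficients. In this form reality is
visibly a closed real-linear condition, stable under integrals and under multipliers with Hermitian
symbol. -/
lemma isRealValued_iff_coeff {f : L2} :
    IsRealValued f ↔ ∀ k, coeffCLM (-k) f = starRingEnd ℂ (coeffCLM k f) := by
  refine ⟨fun h k => ?_, fun h => ?_⟩
  · simpa only [coeffCLM_apply] using mFourierCoeff_neg_of_real h k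
  · have hs : star f = f := ext_coeff fun k => by
      rw [← neg_neg k, h (-k), coeffCLM_apply, coeffCLM_apply, mFourierCoeff, mFourierCoeff,
        ← integral_conj]
      refine integral_congr_ae ?_
      filter_upwards [Lp.coeFn_star f] with x hx
      simp [hx, mFourier_neg]
    filter_upwards [Lp.coeFn_star f] with x hx
    rw [hs] at hx
    exact Complex.conj_eq_iff_im.1 hx.symm

lemma isRealValued_fourierMultiplier {m : Freq → ℂ} (hm : ∀ k, m (-k) = starRingEnd ℂ (m k))
    {f : Torus → ℂ} (hf : ∀ᵐ x : Torus, (f x).im = 0) : IsRealValued (fourierMultiplier m f) := by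
  by_cases h : Memℓp (fun k => m k * mFourierCoeff f k) 2
  · refine isRealValued_iff_coeff.2 fun k => ?_
    rw [coeff_fourierMultiplier h, coeff_fourierMultiplier h, hm, mFourierCoeff_neg_of_real hf,
      map_mul]
  · rw [fourierMultiplier, dif_neg h]
    exact isRealValued_iff_coeff.2 fun k => by simp

lemma IsRealValued.add {f g : L2} (hf : IsRealValued f) (hg : IsRealValued g) :
    IsRealValued (f + g) := by
  rw [isRealValued_iff_coeff] at *
  intro k
  simp [hf k, hg k]

lemma IsRealValued.sub {f g : L2} (hf : IsRealValued f) (hg : IsRealValued g) :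
    IsRealValued (f - g) := by
  rw [isRealValued_iff_coeff] at *
  intro k
  simp [hf k, hg k]

lemma isClosed_isRealValued : IsClosed {f : L2 | IsRealValued f} := by
  simp_rw [isRealValued_iff_coeff, ofPred_forall]
  exact isClosed_iInter fun k => isClosed_eq (by fun_prop)
    (RCLike.continuous_conj.comp (coeffCLM k).continuous)

lemma isRealValued_intervalIntegral {g : ℝ → L2} {a b : ℝ} (hab : a ≤ b)
    (h : ∀ᵐ s ∂(volume.restrict (Ioc a b)), IsRealValued (g s)) :
    IsRealValued (∫ s in a..b, g s) := by
  by_cases hi : IntervalIntegrable g volume a b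
  · refine isRealValued_iff_coeff.2 fun k => ?_
    rw [← ContinuousLinearMap.intervalIntegral_comp_comm _ hi,
      ← ContinuousLinearMap.intervalIntegral_comp_comm _ hi,
      intervalIntegral.integral_of_le hab, intervalIntegral.integral_of_le hab, ← integral_conj]
    exact integral_congr_ae (h.mono fun s hs => isRealValued_iff_coeff.1 hs k)
  -- Without integrability the integral is 0 by convention, which is real.
  · rw [intervalIntegral.integral_undef hi]
    exact isRealValued_iff_coeff.2 fun k => by simp

/-! ### Weighted Cauchy–Schwarz and Young inequalities -/

lemma ennreal_add_sq_le (x y : ℝ≥0∞) : (x + y) ^ 2 ≤ 2 * (x ^ 2 + y ^ 2) := by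
  have := ENNReal.rpow_add_le_mul_rpow_add_rpow x y (p := 2) (by norm_num)
  norm_num at this
  exact this

/-- Cauchy–Schwarz for √f and √f · g, that is, with respect to the measure f dμ. -/
lemma sq_lintegral_mul_le {α : Type*} [MeasurableSpace α] {μ : Measure α} {f g : α → ℝ≥0∞}
    (hf : AEMeasurable f μ) (hg : AEMeasurable g μ) :
    (∫⁻ x, f x * g x ∂μ) ^ 2 ≤ (∫⁻ x, f x ∂μ) * ∫⁻ x, f x * g x ^ 2 ∂μ := by
  have h := ENNReal.lintegral_mul_le_Lp_mul_Lq μ Real.HolderConjugate.two_two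
    (f := fun x => f x ^ (1 / 2 : ℝ)) (g := fun x => f x ^ (1 / 2 : ℝ) * g x)
    (hf.pow_const _) ((hf.pow_const _).mul hg)
  have e : ∀ y : ℝ≥0∞, y ^ (1 / 2 : ℝ) * y ^ (1 / 2 : ℝ) = y := fun y => by
    rw [← ENNReal.rpow_add_of_nonneg _ _ (by norm_num) (by norm_num)]; norm_num
  have e2 : ∀ y : ℝ≥0∞, (y ^ (1 / 2 : ℝ)) ^ 2 = y := fun y => by rw [pow_two, e]
  simp only [Pi.mul_apply, ← mul_assoc, e, ENNReal.rpow_two, mul_pow, e2] at h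
  calc _ ≤ _ := pow_le_pow_left' h 2
    _ = _ := by rw [mul_pow, e2, e2]

lemma sq_tsum_mul_le (f g : Freq → ℝ≥0∞) :
    (∑' k, f k * g k) ^ 2 ≤ (∑' k, f k) * ∑' k, f k * g k ^ 2 := by
  have h := sq_lintegral_mul_le (μ := Measure.count) (f := f) (g := g)
    (measurable_of_countable f).aemeasurable (measurable_of_countable g).aemeasurable
  simpa only [lintegral_count] using h

/-- Young's inequality ℓ¹ ∗ ℓ² ⊆ ℓ²: Cauchy–Schwarz against the weight a, then exchange of the sums
and translation invariance. -/
lemma tsum_sq_conv_le (a b : Freq → ℝ≥0∞) :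
    ∑' k, (∑' j, a j * b (k - j)) ^ 2 ≤ (∑' j, a j) ^ 2 * ∑' k, b k ^ 2 := by
  calc ∑' k, (∑' j, a j * b (k - j)) ^ 2
      ≤ ∑' k, (∑' j, a j) * ∑' j, a j * b (k - j) ^ 2 :=
        ENNReal.tsum_le_tsum fun k => sq_tsum_mul_le a fun j => b (k - j)
    _ = (∑' j, a j) * ∑' j, a j * ∑' k, b (k - j) ^ 2 := by
        rw [ENNReal.tsum_mul_left, ENNReal.tsum_comm]
        simp_rw [ENNReal.tsum_mul_left]
    _ = _ := by
        have e : ∀ j : Freq, ∑' k, b (k - j) ^ 2 = ∑' k, b k ^ 2 := fun j =>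
          (Equiv.subRight j).tsum_eq fun k => b k ^ 2
        simp_rw [e]
        rw [ENNReal.tsum_mul_right, pow_two, mul_assoc]

/-! ### The weight `1 + |k|²` -/

/-- The weight `1 + |k|²`. -/
def weight (k : Freq) : ℝ := 1 + freqSq k

lemma freqSq_nonneg (k : Freq) : 0 ≤ freqSq k := Finset.sum_nonneg fun _ _ => sq_nonneg _

lemma freqSq_neg (k : Freq) : freqSq (-k) = freqSq k := by simp [freqSq]

lemma one_le_weight (k : Freq) : 1 ≤ weight k := by
  have := freqSq_nonneg k
  unfold weight
  linarith

lemma weight_pos (k : Freq) : 0 < weight k := zero_lt_one.trans_le (one_le_weight k)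

lemma weight_neg (k : Freq) : weight (-k) = weight k := by simp [weight, freqSq_neg]

/-- From |x + y|² ≤ 2|x|² + 2|y|². In a convolution this moves the weight onto one of the two
factors. -/
lemma weight_le (k j : Freq) : weight k ≤ 2 * weight j + 2 * weight (k - j) := by
  simp only [weight, freqSq, Fin.sum_univ_two, Pi.sub_apply, Int.cast_sub]
  nlinarith [sq_nonneg ((k 0 : ℝ) - 2 * j 0), sq_nonneg ((k 1 : ℝ) - 2 * j 1)]

lemma summable_weight : Summable fun k => (weight k)⁻¹ ^ 2 := by
  refine Summable.of_norm_bounded_eventually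
    (EisensteinSeries.summable_one_div_norm_rpow (k := 4) (by norm_num)) ?_
  -- The comparison with ‖k‖⁻⁴ fails at k = 0, where that power is 0 by convention. The norm is the
  -- sup norm, so ‖k‖² ≤ |k|².
  filter_upwards [(Set.finite_singleton (0 : Freq)).compl_mem_cofinite] with k hk
  have hk0 : 0 < ‖k‖ := norm_pos_iff.2 hk
  have h1 : ‖k‖ ^ 2 ≤ weight k := by
    obtain ⟨i, hi⟩ : ∃ i, ‖k‖ ≤ ‖k i‖ := by
      by_contra! h
      exact lt_irrefl _ ((pi_norm_lt_iff hk0).2 h)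
    have h2 : ‖k‖ ^ 2 ≤ (k i : ℝ) ^ 2 := by
      rw [← sq_abs (k i : ℝ)]
      gcongr
      simpa [Int.norm_eq_abs] using hi
    have h3 : (k i : ℝ) ^ 2 ≤ freqSq k :=
      Finset.single_le_sum (f := fun i => (k i : ℝ) ^ 2) (fun _ _ => sq_nonneg _)
        (Finset.mem_univ i)
    unfold weight
    linarith
  rw [Real.norm_of_nonneg (by positivity), Real.rpow_neg (norm_nonneg _), inv_pow]
  have h4 : ‖k‖ ^ (4 : ℝ) = (‖k‖ ^ 2) ^ 2 := by
    rw [← pow_mul]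
    exact_mod_cast Real.rpow_natCast ‖k‖ 4
  rw [h4]
  gcongr

/-- The constant `∑ (1 + |k|²)⁻²`. -/
def weightSum : ℝ≥0∞ := ∑' k, ENNReal.ofReal ((weight k)⁻¹ ^ 2)

lemma weightSum_lt_top : weightSum < ∞ := by
  rw [weightSum, ← ENNReal.ofReal_tsum_of_nonneg (fun k => by positivity) summable_weight]
  exact ENNReal.ofReal_lt_top

lemma bessel_bound : ∃ C : ℝ, ∀ k, ‖(((weight k)⁻¹ : ℝ) : ℂ)‖ ≤ C := by
  refine ⟨1, fun k => ?_⟩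
  rw [Complex.norm_real, Real.norm_of_nonneg (inv_nonneg.2 (weight_pos k).le)]
  exact inv_le_one_of_one_le₀ (one_le_weight k)

/-- The Bessel potential `(1 + |k|²)⁻¹`, an isometry of `L²` onto `H²`. -/
def bessel : L2 →L[ℂ] L2 := multCLM (fun k => (((weight k)⁻¹ : ℝ) : ℂ)) bessel_bound

lemma coeff_bessel (p : L2) (k : Freq) :
    coeffCLM k (bessel p) = (((weight k)⁻¹ : ℝ) : ℂ) * coeffCLM k p := coeff_multCLM _ _ _

lemma bessel_injective : Function.Injective bessel := fun p q h => ext_coeff fun k => by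
  have h2 := congrArg (coeffCLM k) h
  rw [coeff_bessel, coeff_bessel] at h2
  exact mul_left_cancel₀ (by simpa using (weight_pos k).ne') h2

lemma enorm_coeff_bessel (p : L2) (k : Freq) :
    ‖coeffCLM k (bessel p)‖ₑ = ENNReal.ofReal (weight k)⁻¹ * ‖coeffCLM k p‖ₑ := by
  rw [coeff_bessel, enorm_mul, ← ofReal_norm (((weight k)⁻¹ : ℝ) : ℂ), Complex.norm_real,
    Real.norm_of_nonneg (inv_nonneg.2 (weight_pos k).le)]

lemma ofReal_weight_mul_inv (k : Freq) :
    ENNReal.ofReal (weight k) * ENNReal.ofReal (weight k)⁻¹ = 1 := by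
  rw [← ENNReal.ofReal_mul (weight_pos k).le, mul_inv_cancel₀ (weight_pos k).ne',
    ENNReal.ofReal_one]

lemma sobolevNorm_two (f : L2) :
    sobolevNorm 2 f ^ 2 = ∑' k, (ENNReal.ofReal (weight k) * ‖coeffCLM k f‖ₑ) ^ 2 := by
  rw [sobolevNorm, ← ENNReal.rpow_natCast, ← ENNReal.rpow_mul]
  norm_num
  refine tsum_congr fun k => ?_
  rw [mul_pow, ← ENNReal.ofReal_pow (weight_pos k).le, coeffCLM_apply, weight]

lemma sobolevNorm_bessel (p : L2) : sobolevNorm 2 (bessel p) = ‖p‖ₑ := by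
  rw [← (ENNReal.pow_right_strictMono two_ne_zero).injective.eq_iff, sobolevNorm_two,
    ← tsum_enorm_sq_coeff]
  refine tsum_congr fun k => ?_
  rw [enorm_coeff_bessel, ← mul_assoc, ofReal_weight_mul_inv, one_mul]

lemma exists_bessel_eq {f : L2} (hf : MemSobolev 2 f) : ∃ p, bessel p = f := by
  have h : Memℓp (fun k => (weight k : ℂ) * coeffCLM k f) 2 := by
    refine memℓp_two_of_tsum_lt_top ?_
    have h2 : sobolevNorm 2 f ^ 2 < ∞ := ENNReal.pow_lt_top hf
    rw [sobolevNorm_two] at h2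
    convert! h2 using 4 with k
    rw [enorm_mul, ← ofReal_norm, Complex.norm_real, Real.norm_of_nonneg (weight_pos k).le]
  refine ⟨ofCoeff _ h, ext_coeff fun k => ?_⟩
  rw [coeff_bessel, coeff_ofCoeff, ← mul_assoc, ← Complex.ofReal_mul,
    inv_mul_cancel₀ (weight_pos k).ne', Complex.ofReal_one, one_mul]

/-- Cauchy–Schwarz with weight (1 + |k|²)⁻²: this is the embedding of H² into functions with
absolutely summable Fourier coefficients, and the place where the dimension enters. -/
lemma tsum_enorm_coeff_bessel_sq_le (p : L2) :
    (∑' k, ‖coeffCLM k (bessel p)‖ₑ) ^ 2 ≤ weightSum * ‖p‖ₑ ^ 2 := by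
  have h := sq_tsum_mul_le (fun k => ENNReal.ofReal ((weight k)⁻¹ ^ 2))
    (fun k => ENNReal.ofReal (weight k) * ‖coeffCLM k p‖ₑ)
  have e : ∀ k, ENNReal.ofReal ((weight k)⁻¹ ^ 2) =
      ENNReal.ofReal (weight k)⁻¹ * ENNReal.ofReal (weight k)⁻¹ := fun k => by
    rw [pow_two, ENNReal.ofReal_mul (inv_nonneg.2 (weight_pos k).le)]
  have e1 : ∀ k, ENNReal.ofReal ((weight k)⁻¹ ^ 2) *
      (ENNReal.ofReal (weight k) * ‖coeffCLM k p‖ₑ) = ‖coeffCLM k (bessel p)‖ₑ := fun k => by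
    rw [enorm_coeff_bessel, e]
    calc _ = (ENNReal.ofReal (weight k) * ENNReal.ofReal (weight k)⁻¹) *
        (ENNReal.ofReal (weight k)⁻¹ * ‖coeffCLM k p‖ₑ) := by ring
      _ = _ := by rw [ofReal_weight_mul_inv, one_mul]
  have e2 : ∀ k, ENNReal.ofReal ((weight k)⁻¹ ^ 2) *
      (ENNReal.ofReal (weight k) * ‖coeffCLM k p‖ₑ) ^ 2 = ‖coeffCLM k p‖ₑ ^ 2 := fun k => by
    rw [e]
    calc _ = (ENNReal.ofReal (weight k) * ENNReal.ofReal (weight k)⁻¹) ^ 2 *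
        ‖coeffCLM k p‖ₑ ^ 2 := by ring
      _ = _ := by rw [ofReal_weight_mul_inv, one_pow, one_mul]
  simp_rw [e1, e2, tsum_enorm_sq_coeff] at h
  exact h

/-! ### Products of functions -/

/-- Fourier coefficients turn products into convolutions. -/
lemma hasSum_coeff_mul (f g : L2) (k : Freq) :
    HasSum (fun j => coeffCLM j f * coeffCLM (k - j) g) (mFourierCoeff (fun x => f x * g x) k) := by
  -- Parseval is applied to f and eₖ · conj g, whose pairing is the k-th coefficient of fg.
  have hm : MemLp (fun x => mFourier k x * starRingEnd ℂ (g x)) 2 (volume : Measure Torus) := by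
    have h1 : MemLp (fun x => starRingEnd ℂ (g x)) 2 (volume : Measure Torus) := (Lp.memLp g).star
    have h2 : MemLp (fun x => mFourier k x) ∞ (volume : Measure Torus) :=
      memLp_top_of_bound (mFourier k).continuous.aestronglyMeasurable 1
        (.of_forall fun x => ((mFourier k).norm_coe_le_norm x).trans mFourier_norm.le)
    exact h1.mul h2
  have h := hasSum_prod_mFourierCoeff hm.toLp f
  have e : (∫ t, starRingEnd ℂ (hm.toLp _ t) * f t) = mFourierCoeff (fun x => f x * g x) k := by
    refine integral_congr_ae ?_
    filter_upwards [hm.coeFn_toLp] with x hx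
    simp only [hx, map_mul, RCLike.conj_conj, mFourier_neg, smul_eq_mul]
    ring
  rw [e] at h
  convert! h using 2 with j
  rw [← coeffCLM_apply j f, mul_comm]
  congr 1
  rw [mFourierCoeff_congr_ae hm.coeFn_toLp, coeffCLM_apply, mFourierCoeff, mFourierCoeff,
    ← integral_conj]
  congr 1
  ext x
  simp only [smul_eq_mul, map_mul, RCLike.conj_conj, mFourier_neg]
  rw [sub_eq_add_neg k j, mFourier_add, mFourier_neg]
  simp only [map_mul, RCLike.conj_conj]
  ring

/-- Functions in `H²(𝕋²)` are bounded. -/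
lemma memLp_top_bessel (p : L2) : MemLp (bessel p) ∞ (volume : Measure Torus) := by
  have hs : Summable fun k => ‖coeffCLM k (bessel p)‖ := by
    have h : (∑' k, ‖coeffCLM k (bessel p)‖ₑ) ^ 2 < ∞ :=
      (tsum_enorm_coeff_bessel_sq_le p).trans_lt
        (ENNReal.mul_lt_top weightSum_lt_top (ENNReal.pow_lt_top enorm_lt_top))
    have h2 : (∑' k, ‖coeffCLM k (bessel p)‖ₑ) ≠ ∞ := fun h3 => by simp [h3] at h
    simpa using ENNReal.summable_toReal h2
  -- The series converges uniformly to a continuous function, which is identified with `bessel p` by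
  -- uniqueness of L² limits.
  have hs2 : Summable fun k => coeffCLM k (bessel p) • (mFourier k : C(Torus, ℂ)) := by
    refine .of_norm ?_
    simpa only [norm_smul, mFourier_norm, mul_one] using hs
  have h1 := hs2.hasSum.mapL (ContinuousMap.toLp (E := ℂ) 2 (volume : Measure Torus) ℂ)
  have h2 := hasSum_mFourier_series_L2 (bessel p)
  simp only [map_smul] at h1
  simp only [← coeffCLM_apply] at h2
  have h3 := h2.unique h1
  rw [h3]
  refine (memLp_top_of_bound (ContinuousMap.continuous _).aestronglyMeasurable _
    (.of_forall fun x => ContinuousMap.norm_coe_le_norm _ x)).ae_eq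
    (ContinuousMap.coeFn_toLp volume _).symm

/-- By `weight_le` the weighted coefficients of the product are at most 2(g ∗ F + f ∗ G), where f, g
are summable and F, G are the square summable weighted versions; Young's inequality bounds both
convolutions. Squaring 2(x + y) costs a factor 8, and two equal terms make it 16. -/
lemma tsum_weight_coeff_mul_le (p q : L2) :
    ∑' k, ‖(weight k : ℂ) * mFourierCoeff (fun x => bessel p x * bessel q x) k‖ₑ ^ 2 ≤
      16 * weightSum * (‖p‖ₑ ^ 2 * ‖q‖ₑ ^ 2) := by
  set f : Freq → ℝ≥0∞ := fun k => ‖coeffCLM k (bessel p)‖ₑ with hf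
  set g : Freq → ℝ≥0∞ := fun k => ‖coeffCLM k (bessel q)‖ₑ with hg
  set F : Freq → ℝ≥0∞ := fun k => ‖coeffCLM k p‖ₑ with hF
  set G : Freq → ℝ≥0∞ := fun k => ‖coeffCLM k q‖ₑ with hG
  have hwf : ∀ k, ENNReal.ofReal (weight k) * f k = F k := fun k => by
    simp only [hf, hF, enorm_coeff_bessel, ← mul_assoc, ofReal_weight_mul_inv, one_mul]
  have hwg : ∀ k, ENNReal.ofReal (weight k) * g k = G k := fun k => by
    simp only [hg, hG, enorm_coeff_bessel, ← mul_assoc, ofReal_weight_mul_inv, one_mul]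
  have h1 : ∀ k, ‖(weight k : ℂ) * mFourierCoeff (fun x => bessel p x * bessel q x) k‖ₑ ≤
      2 * ((∑' j, g j * F (k - j)) + ∑' j, f j * G (k - j)) := fun k => by
    have e : ‖(weight k : ℂ)‖ₑ = ENNReal.ofReal (weight k) := by
      rw [← ofReal_norm, Complex.norm_real, Real.norm_of_nonneg (weight_pos k).le]
    have e2 : (∑' j, g j * F (k - j)) = ∑' j, F j * g (k - j) := by
      rw [← (Equiv.subLeft k).tsum_eq]
      exact tsum_congr fun j => by rw [Equiv.subLeft_apply, sub_sub_cancel, mul_comm]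
    rw [enorm_mul, e, ← (hasSum_coeff_mul (bessel p) (bessel q) k).tsum_eq, e2,
      ← ENNReal.tsum_add, ← ENNReal.tsum_mul_left]
    refine (mul_le_mul_right (enorm_tsum_le_tsum_enorm) _).trans ?_
    rw [← ENNReal.tsum_mul_left]
    refine ENNReal.tsum_le_tsum fun j => ?_
    rw [enorm_mul]
    change ENNReal.ofReal (weight k) * (f j * g (k - j)) ≤ _
    have hw : ENNReal.ofReal (weight k) ≤
        2 * ENNReal.ofReal (weight j) + 2 * ENNReal.ofReal (weight (k - j)) := by
      refine (ENNReal.ofReal_le_ofReal (weight_le k j)).trans_eq ?_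
      rw [ENNReal.ofReal_add (by have := weight_pos j; positivity)
        (by have := weight_pos (k - j); positivity), ENNReal.ofReal_mul zero_le_two,
        ENNReal.ofReal_mul zero_le_two]
      norm_num
    calc _ ≤ _ := mul_le_mul_left hw _
      _ = 2 * ((ENNReal.ofReal (weight j) * f j) * g (k - j) +
          f j * (ENNReal.ofReal (weight (k - j)) * g (k - j))) := by ring
      _ = _ := by rw [hwf, hwg]
  have h2 : ∀ x y : ℝ≥0∞, (2 * (x + y)) ^ 2 ≤ 8 * (x ^ 2 + y ^ 2) := fun x y => by
    rw [mul_pow]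
    refine (mul_le_mul_right (ennreal_add_sq_le x y) _).trans_eq ?_
    rw [← mul_assoc]
    norm_num
  calc _ ≤ ∑' k, 8 * ((∑' j, g j * F (k - j)) ^ 2 + (∑' j, f j * G (k - j)) ^ 2) :=
        ENNReal.tsum_le_tsum fun k => (pow_le_pow_left' (h1 k) 2).trans (h2 _ _)
    _ ≤ 8 * ((∑' j, g j) ^ 2 * ∑' k, F k ^ 2 + (∑' j, f j) ^ 2 * ∑' k, G k ^ 2) := by
        rw [ENNReal.tsum_mul_left, ENNReal.tsum_add]
        gcongr
        · exact tsum_sq_conv_le g F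
        · exact tsum_sq_conv_le f G
    _ ≤ 8 * ((weightSum * ‖q‖ₑ ^ 2) * ‖p‖ₑ ^ 2 + (weightSum * ‖p‖ₑ ^ 2) * ‖q‖ₑ ^ 2) := by
        rw [tsum_enorm_sq_coeff p, tsum_enorm_sq_coeff q]
        gcongr
        · exact tsum_enorm_coeff_bessel_sq_le q
        · exact tsum_enorm_coeff_bessel_sq_le p
    _ = _ := by ring

lemma memℓp_weight_coeff_mul (p q : L2) :
    Memℓp (fun k => (weight k : ℂ) * mFourierCoeff (fun x => bessel p x * bessel q x) k) 2 := by
  refine memℓp_two_of_tsum_lt_top ((tsum_weight_coeff_mul_le p q).trans_lt ?_)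
  exact ENNReal.mul_lt_top (ENNReal.mul_lt_top (by norm_num) weightSum_lt_top)
    (ENNReal.mul_lt_top (ENNReal.pow_lt_top enorm_lt_top) (ENNReal.pow_lt_top enorm_lt_top))

/-- The product on `H²`, transported to `L²` by the Bessel potential. -/
def besselMul (p q : L2) : L2 := ofCoeff _ (memℓp_weight_coeff_mul p q)

lemma bessel_besselMul (p q : L2) :
    bessel (besselMul p q) =ᵐ[volume] fun x => bessel p x * bessel q x := by
  have hm : MemLp (fun x => bessel p x * bessel q x) 2 (volume : Measure Torus) :=
    (Lp.memLp (bessel q)).mul (memLp_top_bessel p)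
  have h : bessel (besselMul p q) = hm.toLp := ext_coeff fun k => by
    rw [coeff_bessel, besselMul, coeff_ofCoeff, coeffCLM_apply,
      mFourierCoeff_congr_ae hm.coeFn_toLp, ← mul_assoc, ← Complex.ofReal_mul,
      inv_mul_cancel₀ (weight_pos k).ne', Complex.ofReal_one, one_mul]
  rw [h]
  exact hm.coeFn_toLp

lemma enorm_besselMul_le (p q : L2) :
    ‖besselMul p q‖ₑ ^ 2 ≤ 16 * weightSum * (‖p‖ₑ ^ 2 * ‖q‖ₑ ^ 2) := by
  rw [← tsum_enorm_sq_coeff]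
  simp_rw [besselMul, coeff_ofCoeff]
  exact tsum_weight_coeff_mul_le p q

lemma norm_besselMul_le (p q : L2) :
    ‖besselMul p q‖ ≤ √(16 * weightSum.toReal) * ‖p‖ * ‖q‖ := by
  refine (pow_le_pow_iff_left₀ (norm_nonneg _) (by positivity) two_ne_zero).1 ?_
  rw [mul_pow, mul_pow, Real.sq_sqrt (by positivity)]
  have h := ENNReal.toReal_mono ?_ (enorm_besselMul_le p q)
  · simpa [ENNReal.toReal_mul, mul_assoc] using h
  · exact (ENNReal.mul_lt_top (ENNReal.mul_lt_top (by norm_num) weightSum_lt_top)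
      (ENNReal.mul_lt_top (ENNReal.pow_lt_top enorm_lt_top)
        (ENNReal.pow_lt_top enorm_lt_top))).ne

lemma besselMul_comm (p q : L2) : besselMul p q = besselMul q p := by
  apply bessel_injective
  apply Lp.ext
  filter_upwards [bessel_besselMul p q, bessel_besselMul q p] with x h1 h2
  rw [h1, h2, mul_comm]

lemma besselMul_add (p q r : L2) : besselMul p (q + r) = besselMul p q + besselMul p r := by
  apply bessel_injective
  apply Lp.ext
  rw [map_add]
  filter_upwards [bessel_besselMul p q, bessel_besselMul p r, bessel_besselMul p (q + r),
    Lp.coeFn_add (bessel (besselMul p q)) (bessel (besselMul p r)),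
    Lp.coeFn_add (bessel q) (bessel r)] with x h1 h2 h3 h4 h5
  rw [h3, h4, map_add, h5, Pi.add_apply, Pi.add_apply, h1, h2, mul_add]

lemma besselMul_smul (p q : L2) (c : ℂ) : besselMul p (c • q) = c • besselMul p q := by
  apply bessel_injective
  apply Lp.ext
  rw [map_smul]
  filter_upwards [bessel_besselMul p q, bessel_besselMul p (c • q),
    Lp.coeFn_smul c (bessel (besselMul p q)), Lp.coeFn_smul c (bessel q)] with x h1 h3 h4 h5
  rw [h3, h4, map_smul, h5, Pi.smul_apply, Pi.smul_apply, h1, smul_eq_mul, smul_eq_mul]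
  ring

/-- `besselMul` as a continuous bilinear map: `H²(𝕋²)` is a Banach algebra. -/
def besselMulCLM : L2 →L[ℂ] L2 →L[ℂ] L2 :=
  LinearMap.mkContinuous₂
    (LinearMap.mk₂ ℂ besselMul
      (fun p q r => by rw [besselMul_comm, besselMul_add, besselMul_comm r, besselMul_comm r])
      (fun c p q => by rw [besselMul_comm, besselMul_smul, besselMul_comm])
      (fun p q r => besselMul_add p q r) (fun c p q => besselMul_smul p q c))
    (√(16 * weightSum.toReal)) fun p q => norm_besselMul_le p q

lemma besselMulCLM_apply (p q : L2) : besselMulCLM p q = besselMul p q := rfl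

/-! ### Abstract parabolic fixed point argument -/

section Abstract

variable {E : Type*} [NormedAddCommGroup E] [NormedSpace ℝ E]

/-- A strongly continuous family of operators on `(0, ∞)`, extended by zero, with an integrable
singularity of order `1/2` at the origin. -/
structure IsSingularKernel (K : ℝ → E →L[ℝ] E) (C : ℝ) : Prop where
  nonneg : 0 ≤ C
  eq_zero : ∀ τ ≤ 0, K τ = 0
  bound : ∀ τ, 0 < τ → τ ≤ 1 → ‖K τ‖ ≤ C * τ ^ (-(1 / 2) : ℝ)
  continuousOn : ∀ x, ContinuousOn (fun τ => K τ x) (Ioi 0)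

/-- The function `s ↦ (t - s)^(-1/2)` on `[t - δ, t)`, extended by zero. -/
def singularBound (t δ : ℝ) : ℝ → ℝ :=
  (Ico (t - δ) t).indicator fun s => (t - s) ^ (-(1 / 2) : ℝ)

lemma singularBound_nonneg (t δ s : ℝ) : 0 ≤ singularBound t δ s :=
  indicator_nonneg (fun _ hs => Real.rpow_nonneg (by linarith [hs.2]) _) s

lemma integrable_singularBound (t : ℝ) {δ : ℝ} (hδ : 0 ≤ δ) : Integrable (singularBound t δ) := by
  rw [singularBound, integrable_indicator_iff measurableSet_Ico, integrableOn_Ico_iff_integrableOn_Ioo,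
    ← integrableOn_Ioc_iff_integrableOn_Ioo,
    ← intervalIntegrable_iff_integrableOn_Ioc_of_le (by linarith)]
  have h := (intervalIntegral.intervalIntegrable_rpow' (a := δ) (b := 0) (r := -(1 / 2))
    (by norm_num)).comp_sub_left t
  simpa using h

/-- That this tends to 0 with δ is the smallness behind both the contraction and the continuity in
time. -/
lemma integral_singularBound (t : ℝ) {δ : ℝ} (hδ : 0 ≤ δ) :
    ∫ s, singularBound t δ s = 2 * √δ := by
  rw [singularBound, integral_indicator measurableSet_Ico, integral_Ico_eq_integral_Ioo,
    ← integral_Ioc_eq_integral_Ioo, ← intervalIntegral.integral_of_le (by linarith),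
    intervalIntegral.integral_comp_sub_left (fun s => s ^ (-(1 / 2) : ℝ)) t,
    integral_rpow (Or.inl (by norm_num)), Real.sqrt_eq_rpow]
  norm_num
  ring

lemma norm_integral_le_of_singularBound {φ : ℝ → E} {μ : Measure ℝ} (hμ : μ ≤ volume)
    {t δ A : ℝ} (hδ : 0 ≤ δ) (hA : 0 ≤ A)
    (h : ∀ᵐ s ∂μ, ‖φ s‖ ≤ A * singularBound t δ s) : ‖∫ s, φ s ∂μ‖ ≤ A * (2 * √δ) := by
  have hi := (integrable_singularBound t hδ).const_mul A
  refine (norm_integral_le_of_norm_le (hi.mono_measure hμ) h).trans ?_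
  refine (integral_mono_measure hμ (.of_forall fun s => mul_nonneg hA (singularBound_nonneg t δ s))
    hi).trans ?_
  rw [integral_const_mul, integral_singularBound t hδ]

namespace IsSingularKernel

variable {K : ℝ → E →L[ℝ] E} {C : ℝ}

lemma aestronglyMeasurable_apply (hK : IsSingularKernel K C) {μ : Measure ℝ} (t : ℝ) (x : E) :
    AEStronglyMeasurable (fun s => K (t - s) x) μ := by
  have h : (fun s => K (t - s) x) = (Iio t).indicator fun s => K (t - s) x := by
    ext s
    by_cases hs : s ∈ Iio t
    · rw [indicator_of_mem hs]
    · rw [indicator_of_notMem hs, hK.eq_zero _ (by simp at hs; linarith)]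
      rfl
  rw [h, aestronglyMeasurable_indicator_iff measurableSet_Iio]
  refine ContinuousOn.aestronglyMeasurable ?_ measurableSet_Iio
  exact (hK.continuousOn x).comp (by fun_prop) fun s hs => by simpa using hs

/-- The kernel is only strongly continuous, so g is approximated by simple functions; on each of
their fibres the argument of the kernel is a fixed vector. -/
lemma aestronglyMeasurable (hK : IsSingularKernel K C) {μ : Measure ℝ} (t : ℝ) {g : ℝ → E}
    (hg : AEStronglyMeasurable g μ) : AEStronglyMeasurable (fun s => K (t - s) (g s)) μ := by
  obtain ⟨g', hg', he⟩ := hg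
  suffices h : AEStronglyMeasurable (fun s => K (t - s) (g' s)) μ from
    h.congr (he.mono fun s hs => by simp only [hs])
  refine aestronglyMeasurable_of_tendsto_ae (u := atTop)
    (f := fun n s => K (t - s) (hg'.approx n s)) (fun n => ?_)
    (.of_forall fun s => ((K (t - s)).continuous.tendsto _).comp (hg'.tendsto_approx s))
  set φ := hg'.approx n
  have h : (fun s => K (t - s) (φ s)) =
      fun s => ∑ y ∈ φ.range, (φ ⁻¹' {y}).indicator (fun s => K (t - s) y) s := by
    ext s
    rw [Finset.sum_eq_single (φ s)]
    · rw [indicator_of_mem (by simp)]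
    · intro y _ hy
      rw [indicator_of_notMem]
      simpa using hy.symm
    · intro hs
      exact absurd (φ.mem_range_self s) hs
  rw [h]
  exact Finset.aestronglyMeasurable_fun_sum _ fun y _ =>
    (hK.aestronglyMeasurable_apply t y).indicator (φ.measurableSet_fiber y)

/-- As the kernel vanishes at nonpositive times, integrals over the fixed interval (a, b] only see s
< t. The length at most 1 keeps t - s in the range of the kernel bound. -/
lemma norm_apply_le (hK : IsSingularKernel K C) {a b t B : ℝ} (hab : b ≤ a + 1)
    (ht : t ∈ Icc a b) {g : ℝ → E} (hg : ∀ᵐ s ∂(volume.restrict (Ioc a b)), ‖g s‖ ≤ B) :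
    ∀ᵐ s ∂(volume.restrict (Ioc a b)), ‖K (t - s) (g s)‖ ≤ C * B * singularBound t (b - a) s := by
  filter_upwards [hg, ae_restrict_mem measurableSet_Ioc] with s hs hsm
  have hB : 0 ≤ B := (norm_nonneg _).trans hs
  rcases le_or_gt t s with h | h
  · rw [hK.eq_zero _ (by linarith)]
    simpa using mul_nonneg (mul_nonneg hK.nonneg hB) (singularBound_nonneg _ _ _)
  · rw [singularBound, indicator_of_mem (show s ∈ Ico (t - (b - a)) t from
      ⟨by linarith [hsm.1, ht.2], h⟩)]
    calc _ ≤ ‖K (t - s)‖ * ‖g s‖ := (K (t - s)).le_opNorm _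
      _ ≤ (C * (t - s) ^ (-(1 / 2) : ℝ)) * B := by
          have := hK.bound (t - s) (by linarith) (by linarith [hsm.1, ht.2])
          gcongr
          exact (norm_nonneg _).trans this
      _ = _ := by ring

lemma norm_integral_le (hK : IsSingularKernel K C) {a b t B : ℝ} (hB : 0 ≤ B) (hab : a ≤ b)
    (hab' : b ≤ a + 1) (ht : t ∈ Icc a b) {g : ℝ → E}
    (hg : ∀ᵐ s ∂(volume.restrict (Ioc a b)), ‖g s‖ ≤ B) :
    ‖∫ s in Ioc a b, K (t - s) (g s)‖ ≤ C * B * (2 * √(b - a)) :=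
  norm_integral_le_of_singularBound Measure.restrict_le_self (by linarith)
    (mul_nonneg hK.nonneg hB) (hK.norm_apply_le hab' ht hg)

lemma integrable (hK : IsSingularKernel K C) {a b t B : ℝ} (hab : a ≤ b)
    (hab' : b ≤ a + 1) (ht : t ∈ Icc a b) {g : ℝ → E}
    (hm : AEStronglyMeasurable g (volume.restrict (Ioc a b)))
    (hg : ∀ᵐ s ∂(volume.restrict (Ioc a b)), ‖g s‖ ≤ B) :
    IntegrableOn (fun s => K (t - s) (g s)) (Ioc a b) :=
  Integrable.mono' (((integrable_singularBound t (sub_nonneg.2 hab)).const_mul (C * B)).mono_measure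
    Measure.restrict_le_self) (hK.aestronglyMeasurable t hm) (hK.norm_apply_le hab' ht hg)

/-- Removing the part t - δ ≤ s of the integral changes it by at most a multiple of √δ, uniformly in
t. What remains has a bounded integrand and is continuous by dominated convergence. -/
lemma continuousOn_integral (hK : IsSingularKernel K C) {a b B : ℝ} (hB : 0 ≤ B) (hab : a ≤ b)
    (hab' : b ≤ a + 1) {g : ℝ → E} (hm : AEStronglyMeasurable g (volume.restrict (Ioc a b)))
    (hg : ∀ᵐ s ∂(volume.restrict (Ioc a b)), ‖g s‖ ≤ B) :
    ContinuousOn (fun t => ∫ s in Ioc a b, K (t - s) (g s)) (Icc a b) := by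
  refine continuousOn_of_uniform_approx_of_continuousOn fun u hu => ?_
  obtain ⟨ε, hε, hεu⟩ := Metric.mem_uniformity_dist.1 hu
  obtain ⟨δ, hδ, hδε⟩ : ∃ δ > 0, C * B * (2 * √δ) < ε := by
    have h : Tendsto (fun δ : ℝ => C * B * (2 * √δ)) (𝓝[>] 0) (𝓝 (C * B * (2 * √0))) :=
      (Continuous.tendsto (by fun_prop) 0).mono_left nhdsWithin_le_nhds
    rw [Real.sqrt_zero, mul_zero, mul_zero] at h
    obtain ⟨δ, h1, h2⟩ := ((h.eventually (gt_mem_nhds hε)).and self_mem_nhdsWithin).exists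
    exact ⟨δ, h2, h1⟩
  have hmt : ∀ t, AEStronglyMeasurable ((Iio (t - δ)).indicator fun s => K (t - s) (g s))
      (volume.restrict (Ioc a b)) := fun t =>
    (hK.aestronglyMeasurable t hm).indicator measurableSet_Iio
  refine ⟨fun t => ∫ s in Ioc a b, (Iio (t - δ)).indicator (fun s => K (t - s) (g s)) s, ?_, ?_⟩
  · intro t₀ ht₀
    refine continuousWithinAt_of_dominated (bound := fun _ => C * B * δ ^ (-(1 / 2) : ℝ))
      (.of_forall hmt) ?_ ?_ ?_
    · filter_upwards [self_mem_nhdsWithin] with t ht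
      filter_upwards [hg, ae_restrict_mem measurableSet_Ioc] with s hs hsm
      by_cases h : s ∈ Iio (t - δ)
      · rw [indicator_of_mem h]
        have hts : δ < t - s := by have : s < t - δ := h; linarith
        calc _ ≤ ‖K (t - s)‖ * ‖g s‖ := (K (t - s)).le_opNorm _
          _ ≤ (C * (t - s) ^ (-(1 / 2) : ℝ)) * B := by
              have := hK.bound (t - s) (by linarith) (by linarith [hsm.1, ht.2])
              gcongr
              exact (norm_nonneg _).trans this
          _ ≤ (C * δ ^ (-(1 / 2) : ℝ)) * B := by
              have := hK.nonneg
              have := Real.rpow_le_rpow_of_nonpos hδ hts.le (by norm_num : (-(1 / 2) : ℝ) ≤ 0)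
              gcongr
          _ = _ := by ring
      · rw [indicator_of_notMem h, norm_zero]
        have := hK.nonneg
        positivity
    · exact integrable_const _
    -- The truncated integrand can jump at t₀ only for this single value of s.
    · have hne : ∀ᵐ s ∂(volume.restrict (Ioc a b)), s ≠ t₀ - δ :=
        ae_restrict_of_ae (Measure.ae_ne volume _)
      filter_upwards [hne] with s hs
      refine ContinuousAt.continuousWithinAt ?_
      rcases lt_or_gt_of_ne hs with h | h
      · have h1 : ContinuousAt (fun t => K (t - s) (g s)) t₀ :=
          ContinuousAt.comp (f := fun t => t - s) (g := fun τ => K τ (g s))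
            ((hK.continuousOn (g s)).continuousAt (Ioi_mem_nhds (by linarith))) (by fun_prop)
        refine h1.congr ?_
        filter_upwards [lt_mem_nhds (show s + δ < t₀ by linarith)] with t ht
        rw [indicator_of_mem (mem_Iio.2 (by linarith))]
      · refine (continuousAt_const (y := (0 : E))).congr ?_
        filter_upwards [gt_mem_nhds (show t₀ < s + δ by linarith)] with t ht
        rw [indicator_of_notMem (by rw [mem_Iio]; linarith)]
  · intro t ht
    refine hεu ?_
    have hi := hK.integrable hab hab' ht hm hg
    rw [dist_eq_norm, ← integral_sub hi (hi.indicator measurableSet_Iio)]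
    refine (norm_integral_le_of_singularBound (t := t) (δ := δ) (A := C * B)
      Measure.restrict_le_self hδ.le (mul_nonneg hK.nonneg hB) ?_).trans_lt hδε
    filter_upwards [hK.norm_apply_le hab' ht hg] with s hs
    by_cases h : s ∈ Iio (t - δ)
    · rw [indicator_of_mem h, sub_self, norm_zero]
      exact mul_nonneg (mul_nonneg hK.nonneg hB) (singularBound_nonneg _ _ _)
    · rw [indicator_of_notMem h, sub_zero]
      refine hs.trans (mul_le_mul_of_nonneg_left ?_ (mul_nonneg hK.nonneg hB))
      rw [singularBound, singularBound]
      by_cases h2 : s ∈ Ico (t - δ) t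
      · rw [indicator_of_mem h2]
        exact indicator_apply_le' (fun _ => le_rfl)
          fun _ => Real.rpow_nonneg (by linarith [h2.2]) _
      · rw [indicator_of_notMem h2, indicator_of_notMem]
        rintro ⟨_, h4⟩
        exact h2 ⟨not_lt.1 h, h4⟩

end IsSingularKernel

/-- Local solvability of `w(t) = S(t - a) w₁ + ∫ₐᵗ K(t - s) G(s, w(s)) ds`, with a time of existence
depending only on the size of `w₁`; solutions stay in a closed set that is preserved by all the
ingredients. -/
theorem exists_local_solution [CompleteSpace E] {K S : ℝ → E →L[ℝ] E} {C : ℝ}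
    (hK : IsSingularKernel K C) (hSb : ∀ τ, 0 ≤ τ → ‖S τ‖ ≤ 1)
    (hSc : ∀ x, ContinuousOn (fun τ => S τ x) (Ici 0)) {G : ℝ → E → E}
    (hGm : ∀ w : ℝ → E, Continuous w →
      AEStronglyMeasurable (fun s => G s (w s)) (volume.restrict (Ici 0)))
    (hGl : ∀ R : ℝ, ∃ L : ℝ, 0 ≤ L ∧ ∀ᵐ s ∂(volume.restrict (Ici (0 : ℝ))), ∀ x y,
      ‖x‖ ≤ R → ‖y‖ ≤ R → ‖G s x - G s y‖ ≤ L * ‖x - y‖)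
    (hG0 : ∀ s, G s 0 = 0) {P : Set E} (hPc : IsClosed P) (hP0 : 0 ∈ P)
    (hPadd : ∀ x ∈ P, ∀ y ∈ P, x + y ∈ P)
    (hPi : ∀ (g : ℝ → E) (a b : ℝ), a ≤ b → (∀ᵐ s ∂(volume.restrict (Ioc a b)), g s ∈ P) →
      ∫ s in a..b, g s ∈ P)
    (hPS : ∀ τ, ∀ x ∈ P, S τ x ∈ P) (hPK : ∀ τ, ∀ x ∈ P, K τ x ∈ P)
    (hPG : ∀ᵐ s ∂(volume.restrict (Ici (0 : ℝ))), ∀ x ∈ P, G s x ∈ P) (R : ℝ) :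
    ∃ h : ℝ, 0 < h ∧ ∀ a, 0 ≤ a → ∀ w₁ ∈ P, ‖w₁‖ ≤ R → ∃ w : ℝ → E, Continuous w ∧
      (∀ t, w t ∈ P) ∧ ∀ t ∈ Icc a (a + h),
        IntervalIntegrable (fun s => K (t - s) (G s (w s))) volume a t ∧
        w t = S (t - a) w₁ + ∫ s in a..t, K (t - s) (G s (w s)) := by
  rcases lt_or_ge R 0 with hR | hR
  · exact ⟨1, one_pos, fun a _ w₁ _ hw₁ => absurd ((norm_nonneg _).trans hw₁) (not_le.2 hR)⟩
  -- The ball of radius R + 1 leaves room 1 for the Duhamel integral, since the linear part has norm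
  -- at most R.
  obtain ⟨L, hL, hGL⟩ := hGl (R + 1)
  -- One condition serves twice: it bounds the integral term by 1/2 and, since R + 1 ≥ 1, gives the
  -- contraction factor 1/2. It involves R but not a.
  obtain ⟨h, hh0, hh1, hh⟩ : ∃ h : ℝ, 0 < h ∧ h ≤ 1 ∧
      C * (L * (R + 1)) * (2 * √h) ≤ 1 / 2 := by
    have h : Tendsto (fun δ : ℝ => C * (L * (R + 1)) * (2 * √δ)) (𝓝[>] 0)
        (𝓝 (C * (L * (R + 1)) * (2 * √0))) :=
      (Continuous.tendsto (by fun_prop) 0).mono_left nhdsWithin_le_nhds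
    rw [Real.sqrt_zero, mul_zero, mul_zero] at h
    obtain ⟨δ, ⟨h1, h2⟩, h3⟩ := (((h.eventually (gt_mem_nhds (by norm_num : (0 : ℝ) < 1 / 2))).and
      (nhdsWithin_le_nhds (Iic_mem_nhds zero_lt_one))).and self_mem_nhdsWithin).exists
    exact ⟨δ, h3, h2, h1.le⟩
  refine ⟨h, hh0, fun a ha w₁ hw₁P hw₁ => ?_⟩
  set b := a + h with hb
  have hab : a ≤ b := by linarith
  have hab' : b ≤ a + 1 := by linarith
  have hba : b - a = h := by linarith
  have hsub : Ioc a b ⊆ Ici 0 := fun s hs => ha.trans hs.1.le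
  set B := L * (R + 1) with hBdef
  have hB : 0 ≤ B := by positivity
  -- Clamping time to [a, b] lets the iteration run on bounded continuous functions on the whole
  -- line.
  set p : ℝ → ℝ := fun t => max a (min t b) with hp
  have hpm : ∀ t, p t ∈ Icc a b := fun t =>
    ⟨le_max_left _ _, max_le hab (min_le_right _ _)⟩
  have hpc : Continuous p := by fun_prop
  let X := {w : BoundedContinuousFunction ℝ E // (∀ t, ‖w t‖ ≤ R + 1) ∧ ∀ t, w t ∈ P}
  have hXc : IsClosed {w : BoundedContinuousFunction ℝ E |
      (∀ t, ‖w t‖ ≤ R + 1) ∧ ∀ t, w t ∈ P} := by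
    have hev : ∀ t, Continuous fun w : BoundedContinuousFunction ℝ E => w t := fun t =>
      (BoundedContinuousFunction.lipschitz_eval_const t).continuous
    refine IsClosed.inter (s₁ := {w : BoundedContinuousFunction ℝ E | ∀ t, ‖w t‖ ≤ R + 1})
      (s₂ := {w : BoundedContinuousFunction ℝ E | ∀ t, w t ∈ P}) ?_ ?_
    · rw [Set.ofPred_forall]
      exact isClosed_iInter fun t => isClosed_le (hev t).norm continuous_const
    · rw [Set.ofPred_forall]
      exact isClosed_iInter fun t => hPc.preimage (hev t)
  have : CompleteSpace X := hXc.completeSpace_coe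
  have : Nonempty X := ⟨⟨0, fun t => by simpa using by linarith, fun t => hP0⟩⟩
  have hm : ∀ w : X, AEStronglyMeasurable (fun s => G s (w.1 s)) (volume.restrict (Ioc a b)) :=
    fun w => (hGm w.1 w.1.continuous).mono_measure (Measure.restrict_mono_set _ hsub)
  have hGLab := ae_restrict_of_ae_restrict_of_subset hsub hGL
  have hg : ∀ w : X, ∀ᵐ s ∂(volume.restrict (Ioc a b)), ‖G s (w.1 s)‖ ≤ B := fun w => by
    filter_upwards [hGLab] with s hs
    have := hs (w.1 s) 0 (w.2.1 s) (by simpa using by linarith)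
    rw [hG0, sub_zero, sub_zero] at this
    exact this.trans (mul_le_mul_of_nonneg_left (w.2.1 s) hL)
  have hΦ : ∀ w : X, ∃ w' : X, ∀ t,
      w'.1 t = S (p t - a) w₁ + ∫ s in Ioc a b, K (p t - s) (G s (w.1 s)) := fun w => by
    have hn : ∀ t, ‖S (p t - a) w₁ + ∫ s in Ioc a b, K (p t - s) (G s (w.1 s))‖ ≤ R + 1 := by
      intro t
      refine (norm_add_le _ _).trans (add_le_add ?_ ?_)
      · refine ((S _).le_opNorm _).trans ?_
        have := hSb (p t - a) (by linarith [(hpm t).1])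
        nlinarith [norm_nonneg w₁, norm_nonneg (S (p t - a))]
      · refine (hK.norm_integral_le hB hab hab' (hpm t) (hg w)).trans ?_
        rw [hba]
        linarith
    have hc : Continuous fun t => S (p t - a) w₁ + ∫ s in Ioc a b, K (p t - s) (G s (w.1 s)) := by
      refine Continuous.add ?_ ?_
      · exact (hSc w₁).comp_continuous (f := fun t => p t - a) (by fun_prop)
          fun t => by simpa using (hpm t).1
      · exact (hK.continuousOn_integral hB hab hab' (hm w) (hg w)).comp_continuous hpc hpm
    refine ⟨⟨BoundedContinuousFunction.ofNormedAddCommGroup _ hc _ hn, hn, fun t => ?_⟩,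
      fun t => rfl⟩
    refine hPadd _ (hPS _ _ hw₁P) _ ?_
    have := hPi (fun s => K (p t - s) (G s (w.1 s))) a b hab ?_
    · rwa [intervalIntegral.integral_of_le hab] at this
    · filter_upwards [ae_restrict_of_ae_restrict_of_subset hsub hPG] with s hs
      exact hPK _ _ (hs _ (w.2.2 s))
  choose Φ hΦ using hΦ
  have hcontr : ContractingWith (1 / 2) Φ := by
    refine ⟨by norm_num, LipschitzWith.of_dist_le_mul fun w w' => ?_⟩
    refine (BoundedContinuousFunction.dist_le (by positivity)).2 fun t => ?_
    rw [hΦ, hΦ, dist_add_left, dist_eq_norm,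
      ← integral_sub (hK.integrable hab hab' (hpm t) (hm w) (hg w))
        (hK.integrable hab hab' (hpm t) (hm w') (hg w'))]
    simp_rw [← map_sub]
    refine (hK.norm_integral_le (B := L * dist w w') (by positivity) hab hab' (hpm t) ?_).trans ?_
    · filter_upwards [hGLab] with s hs
      refine (hs _ _ (w.2.1 s) (w'.2.1 s)).trans (mul_le_mul_of_nonneg_left ?_ hL)
      rw [← dist_eq_norm]
      exact BoundedContinuousFunction.dist_coe_le_dist s
    · rw [hba]
      have h1 : C * L * (2 * √h) ≤ 1 / 2 := by
        refine le_trans ?_ hh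
        have := hK.nonneg
        rw [hBdef]
        gcongr
        nlinarith
      calc _ = C * L * (2 * √h) * dist w w' := by ring
        _ ≤ 1 / 2 * dist w w' := by gcongr
        _ = _ := by simp
  obtain ⟨w, hw⟩ : ∃ w : X, Φ w = w := ⟨_, hcontr.fixedPoint_isFixedPt⟩
  refine ⟨w.1, w.1.continuous, w.2.2, fun t ht => ⟨?_, ?_⟩⟩
  · rw [intervalIntegrable_iff_integrableOn_Ioc_of_le ht.1]
    exact (hK.integrable hab hab' ht (hm w) (hg w)).mono_set (Ioc_subset_Ioc_right ht.2)
  have hpt : p t = t := by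
    simp only [hp, min_eq_left ht.2, max_eq_right ht.1]
  have h1 := hΦ w t
  rw [hw, hpt] at h1
  rw [h1, intervalIntegral.integral_of_le ht.1]
  congr 1
  -- The kernel vanishes on (t, b], so the integral over (a, b] is the one over (a, t].
  refine setIntegral_eq_of_subset_of_forall_sdiff_eq_zero measurableSet_Ioc
    (Ioc_subset_Ioc_right ht.2) fun s hs => ?_
  have : t < s := by
    by_contra! h
    exact hs.2 ⟨hs.1.1, h⟩
  rw [hK.eq_zero _ (by linarith)]
  rfl

end Abstract

/-! ### Multiplication by bounded functions and the advection term -/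

open Classical in
/-- The pointwise product of two `L²` functions, if it belongs to `L²` (and `0` otherwise). -/
def mulLp (w f : L2) : L2 :=
  if h : MemLp (fun x => w x * f x) 2 (volume : Measure Torus) then h.toLp else 0

lemma memLp_mul {w : L2} (hw : MemLp w ∞ (volume : Measure Torus)) (f : L2) :
    MemLp (fun x => w x * f x) 2 (volume : Measure Torus) := (Lp.memLp f).mul hw

lemma coeFn_mulLp {w : L2} (hw : MemLp w ∞ (volume : Measure Torus)) (f : L2) :
    mulLp w f =ᵐ[volume] fun x => w x * f x := by
  rw [mulLp, dif_pos (memLp_mul hw f)]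
  exact (memLp_mul hw f).coeFn_toLp

lemma mulLp_zero (w : L2) : mulLp w 0 = 0 := by
  rw [mulLp]
  split_ifs with h
  · apply Lp.ext
    filter_upwards [h.coeFn_toLp, Lp.coeFn_zero ℂ 2 (volume : Measure Torus)] with x h1 h2
    rw [h1, h2]
    simp
  · rfl

lemma mulLp_sub {w : L2} (hw : MemLp w ∞ (volume : Measure Torus)) (f g : L2) :
    mulLp w f - mulLp w g = mulLp w (f - g) := by
  apply Lp.ext
  filter_upwards [coeFn_mulLp hw f, coeFn_mulLp hw g, coeFn_mulLp hw (f - g),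
    Lp.coeFn_sub (mulLp w f) (mulLp w g), Lp.coeFn_sub f g] with x h1 h2 h3 h4 h5
  rw [h4, h3, h5, Pi.sub_apply, Pi.sub_apply, h1, h2, mul_sub]

lemma norm_mulLp_le {w : L2} {M : ℝ≥0} (hw : eLpNorm w ∞ (volume : Measure Torus) ≤ M) (f : L2) :
    ‖mulLp w f‖ ≤ M * ‖f‖ := by
  have hw' : MemLp w ∞ (volume : Measure Torus) :=
    ⟨(Lp.memLp w).1, hw.trans_lt ENNReal.coe_lt_top⟩
  rw [mulLp, dif_pos (memLp_mul hw' f), Lp.norm_toLp, Lp.norm_def]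
  have h : eLpNorm (fun x => w x * f x) 2 (volume : Measure Torus) ≤
      eLpNorm w ∞ (volume : Measure Torus) * eLpNorm f 2 (volume : Measure Torus) :=
    eLpNorm_smul_le_eLpNorm_top_mul_eLpNorm (φ := fun x => w x) (f := fun x => f x) 2 (Lp.memLp f).1
  refine (ENNReal.toReal_mono ?_ (h.trans (mul_le_mul_left hw _))).trans_eq ?_
  · exact (ENNReal.mul_lt_top ENNReal.coe_lt_top (Lp.memLp f).2).ne
  · rw [ENNReal.toReal_mul, ENNReal.coe_toReal]

lemma hasSum_coeff_mulLp {w : L2} (hw : MemLp w ∞ (volume : Measure Torus)) (f : L2) (k : Freq) :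
    HasSum (fun j => coeffCLM j w * coeffCLM (k - j) f) (coeffCLM k (mulLp w f)) := by
  rw [coeffCLM_apply k, mFourierCoeff_congr_ae (coeFn_mulLp hw f)]
  exact hasSum_coeff_mul w f k

/-- Each coefficient of the product is a pointwise limit of finite sums of products of measurable
scalars. Hence measurability of w in L² suffices, although the product needs w bounded. -/
lemma aestronglyMeasurable_mulLp {α : Type*} [MeasurableSpace α] {μ : Measure α} {w f : α → L2}
    (hw : AEStronglyMeasurable w μ) (hf : AEStronglyMeasurable f μ)
    (hb : ∀ᵐ s ∂μ, MemLp (w s) ∞ (volume : Measure Torus)) :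
    AEStronglyMeasurable (fun s => mulLp (w s) (f s)) μ := by
  refine aestronglyMeasurable_of_coeff fun k => ?_
  refine aestronglyMeasurable_of_tendsto_ae (u := (atTop : Filter (Finset Freq)))
    (f := fun S s => ∑ j ∈ S, coeffCLM j (w s) * coeffCLM (k - j) (f s)) (fun S => ?_) ?_
  · exact Finset.aestronglyMeasurable_fun_sum _ fun j _ =>
      ((coeffCLM j).continuous.comp_aestronglyMeasurable hw).mul
        ((coeffCLM (k - j)).continuous.comp_aestronglyMeasurable hf)
  · exact hb.mono fun s hs => hasSum_coeff_mulLp hs (f s) k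

lemma abs_le_weight (k : Freq) (j : Fin 2) : |(k j : ℝ)| ≤ weight k := by
  have h3 : (k j : ℝ) ^ 2 ≤ freqSq k :=
    Finset.single_le_sum (f := fun i => (k i : ℝ) ^ 2) (fun _ _ => sq_nonneg _) (Finset.mem_univ j)
  unfold weight
  nlinarith [sq_abs (k j : ℝ), sq_nonneg (|(k j : ℝ)| - 1)]

lemma deriv_bound (j : Fin 2) : ∃ C : ℝ, ∀ k : Freq,
    ‖2 * Real.pi * Complex.I * (k j : ℂ) * (((weight k)⁻¹ : ℝ) : ℂ)‖ ≤ C := by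
  refine ⟨2 * Real.pi, fun k => ?_⟩
  have h : |(k j : ℝ)| * (weight k)⁻¹ ≤ 1 := by
    rw [← div_eq_mul_inv, div_le_one (weight_pos k)]
    exact abs_le_weight k j
  have e : ‖2 * Real.pi * Complex.I * (k j : ℂ) * (((weight k)⁻¹ : ℝ) : ℂ)‖ =
      2 * Real.pi * (|(k j : ℝ)| * (weight k)⁻¹) := by
    simp only [norm_mul, Complex.norm_real, Complex.norm_I, Complex.norm_ofNat,
      Complex.norm_intCast, Real.norm_of_nonneg Real.pi_pos.le,
      Real.norm_of_nonneg (inv_nonneg.2 (weight_pos k).le)]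
    ring
  rw [e]
  nlinarith [Real.pi_pos]

/-- The operator `∂ⱼ (1 + |k|²)⁻¹`, bounded on `L²`. -/
def derivBessel (j : Fin 2) : L2 →L[ℂ] L2 :=
  multCLM (fun k => 2 * Real.pi * Complex.I * (k j : ℂ) * (((weight k)⁻¹ : ℝ) : ℂ)) (deriv_bound j)

/-- Composition of a possibly unbounded multiplier with the Bessel potential. -/
lemma fourierMultiplier_bessel {m : Freq → ℂ}
    (hm : ∃ C : ℝ, ∀ k, ‖m k * (((weight k)⁻¹ : ℝ) : ℂ)‖ ≤ C) (p : L2) :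
    fourierMultiplier m (bessel p) = multCLM (fun k => m k * (((weight k)⁻¹ : ℝ) : ℂ)) hm p := by
  obtain ⟨C, hC⟩ := id hm
  have e : ∀ k, m k * mFourierCoeff (bessel p : Torus → ℂ) k =
      m k * (((weight k)⁻¹ : ℝ) : ℂ) * coeffCLM k p := fun k => by
    rw [← coeffCLM_apply, coeff_bessel, mul_assoc]
  refine ext_coeff fun k => ?_
  rw [coeff_fourierMultiplier, e, coeff_multCLM]
  simp_rw [e, coeffCLM_apply]
  exact memℓp_mul_coeff hC p

lemma partialDeriv_bessel (j : Fin 2) (p : L2) : partialDeriv j (bessel p) = derivBessel j p :=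
  fourierMultiplier_bessel (deriv_bound j) p

/-- The advection term `w · ∇f` with `f = (1 + |k|²)⁻¹ p`, as an element of `L²`. -/
def advectionL2 (w : Fin 2 → L2) (p : L2) : L2 := ∑ i, mulLp (w i) (derivBessel i p)

lemma coeFn_advectionL2 {w : Fin 2 → L2} (hw : ∀ i, MemLp (w i) ∞ (volume : Measure Torus))
    (p : L2) : advectionL2 w p =ᵐ[volume] advection w (bessel p) := by
  filter_upwards [coeFn_mulLp (hw 0) (derivBessel 0 p), coeFn_mulLp (hw 1) (derivBessel 1 p),
    Lp.coeFn_add (mulLp (w 0) (derivBessel 0 p)) (mulLp (w 1) (derivBessel 1 p))] with x h0 h1 h2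
  simp only [advectionL2, advection, Fin.sum_univ_two, partialDeriv_bessel]
  rw [h2, Pi.add_apply, h0, h1]

lemma advectionL2_zero (w : Fin 2 → L2) : advectionL2 w 0 = 0 := by
  simp [advectionL2, mulLp_zero]

/-- Linearity in p, Hölder's inequality L^∞ · L² ⊆ L², and boundedness of ∂ᵢ(1 + |k|²)⁻¹ on L². -/
lemma norm_advectionL2_sub_le {w : Fin 2 → L2} {M : ℝ≥0}
    (hw : ∀ i, eLpNorm (w i) ∞ (volume : Measure Torus) ≤ M) (p q : L2) :
    ‖advectionL2 w p - advectionL2 w q‖ ≤ M * (∑ i, ‖derivBessel i‖) * ‖p - q‖ := by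
  have hw' : ∀ i, MemLp (w i) ∞ (volume : Measure Torus) := fun i =>
    ⟨(Lp.memLp (w i)).1, (hw i).trans_lt ENNReal.coe_lt_top⟩
  rw [advectionL2, advectionL2, ← Finset.sum_sub_distrib, mul_assoc, Finset.sum_mul,
    Finset.mul_sum]
  refine norm_sum_le_of_le _ fun i _ => ?_
  rw [mulLp_sub (hw' i), ← map_sub]
  refine (norm_mulLp_le (hw i) _).trans ?_
  gcongr
  exact (derivBessel i).le_opNorm _

lemma aestronglyMeasurable_advectionL2 {α : Type*} [MeasurableSpace α] {μ : Measure α}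
    {v : α → Fin 2 → L2} {p : α → L2} (hv : ∀ i, AEStronglyMeasurable (fun s => v s i) μ)
    (hp : AEStronglyMeasurable p μ)
    (hb : ∀ᵐ s ∂μ, ∀ i, MemLp (v s i) ∞ (volume : Measure Torus)) :
    AEStronglyMeasurable (fun s => advectionL2 (v s) (p s)) μ :=
  Finset.aestronglyMeasurable_fun_sum _ fun i _ => aestronglyMeasurable_mulLp (hv i)
    ((derivBessel i).continuous.comp_aestronglyMeasurable hp) (hb.mono fun _ h => h i)

lemma isRealValued_multCLM {m : Freq → ℂ} (hm : ∃ C : ℝ, ∀ k, ‖m k‖ ≤ C)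
    (hs : ∀ k, m (-k) = starRingEnd ℂ (m k)) {p : L2} (hp : IsRealValued p) :
    IsRealValued (multCLM m hm p) := isRealValued_fourierMultiplier hs hp

lemma isRealValued_bessel {p : L2} (hp : IsRealValued p) : IsRealValued (bessel p) :=
  isRealValued_multCLM _ (fun k => by rw [weight_neg, Complex.conj_ofReal]) hp

lemma isRealValued_of_bessel {p : L2} (hp : IsRealValued (bessel p)) : IsRealValued p := by
  rw [isRealValued_iff_coeff] at hp ⊢
  intro k
  have h := hp k
  rw [coeff_bessel, coeff_bessel, weight_neg, map_mul, Complex.conj_ofReal] at h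
  exact mul_left_cancel₀ (by simpa using (weight_pos k).ne') h

lemma isRealValued_derivBessel (j : Fin 2) {p : L2} (hp : IsRealValued p) :
    IsRealValued (derivBessel j p) :=
  isRealValued_multCLM _ (fun k => by simp [weight_neg, Complex.conj_ofNat]) hp

lemma isRealValued_advectionL2 {w : Fin 2 → L2} (hw : ∀ i, MemLp (w i) ∞ (volume : Measure Torus))
    (hr : ∀ i, IsRealValued (w i)) {p : L2} (hp : IsRealValued p) :
    IsRealValued (advectionL2 w p) := by
  have h : ∀ i, IsRealValued (mulLp (w i) (derivBessel i p)) := fun i => by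
    filter_upwards [coeFn_mulLp (hw i) (derivBessel i p), hr i, isRealValued_derivBessel i hp]
      with x h1 h2 h3
    rw [h1, Complex.mul_im, h2, h3]
    ring
  rw [advectionL2, Fin.sum_univ_two]
  exact (h 0).add (h 1)

/-! ### The nonlinear term -/

lemma laplacian_bound : ∃ C : ℝ, ∀ k : Freq,
    ‖((-(4 * Real.pi ^ 2 * freqSq k) : ℝ) : ℂ) * (((weight k)⁻¹ : ℝ) : ℂ)‖ ≤ C := by
  refine ⟨4 * Real.pi ^ 2, fun k => ?_⟩
  have h : freqSq k * (weight k)⁻¹ ≤ 1 := by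
    rw [← div_eq_mul_inv, div_le_one (weight_pos k), weight]
    linarith
  have h0 := freqSq_nonneg k
  have h1 := weight_pos k
  rw [← Complex.ofReal_mul, Complex.norm_real, neg_mul, norm_neg,
    Real.norm_of_nonneg (by positivity)]
  nlinarith [sq_nonneg Real.pi]

/-- The operator `Δ (1 + |k|²)⁻¹`, bounded on `L²`. -/
def laplacianBessel : L2 →L[ℂ] L2 :=
  multCLM (fun k => ((-(4 * Real.pi ^ 2 * freqSq k) : ℝ) : ℂ) * (((weight k)⁻¹ : ℝ) : ℂ))
    laplacian_bound

/-- The nonlinear term `Δ(a f³ + b f² + c f)` with `f = (1 + |k|²)⁻¹ p`. -/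
def nonlinearL2 (a b c : ℝ) (p : L2) : L2 :=
  laplacianBessel ((a : ℂ) • besselMulCLM p (besselMulCLM p p) + (b : ℂ) • besselMulCLM p p +
    (c : ℂ) • p)

lemma cubic_ae_eq (a b c : ℝ) (p : L2) :
    (fun x => (a : ℂ) * bessel p x ^ 3 + b * bessel p x ^ 2 + c * bessel p x) =ᵐ[volume]
      bessel ((a : ℂ) • besselMulCLM p (besselMulCLM p p) + (b : ℂ) • besselMulCLM p p +
        (c : ℂ) • p) := by
  simp only [map_add, map_smul, besselMulCLM_apply]
  filter_upwards [bessel_besselMul p p, bessel_besselMul p (besselMul p p),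
    Lp.coeFn_add ((a : ℂ) • bessel (besselMul p (besselMul p p)) +
      (b : ℂ) • bessel (besselMul p p)) ((c : ℂ) • bessel p),
    Lp.coeFn_add ((a : ℂ) • bessel (besselMul p (besselMul p p)))
      ((b : ℂ) • bessel (besselMul p p)),
    Lp.coeFn_smul (a : ℂ) (bessel (besselMul p (besselMul p p))),
    Lp.coeFn_smul (b : ℂ) (bessel (besselMul p p)), Lp.coeFn_smul (c : ℂ) (bessel p)]
    with x h1 h2 h3 h4 h5 h6 h7
  rw [h3, Pi.add_apply, h4, Pi.add_apply, h5, h6, h7, Pi.smul_apply, Pi.smul_apply, Pi.smul_apply,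
    h2, h1]
  simp only [smul_eq_mul]
  ring

/-- The cubic of an H² function is again in H², so its Laplacian is a genuine L² function and the
default branch of `fourierMultiplier` is not taken. -/
lemma nonlinearTerm_bessel (a b c : ℝ) (p : L2) :
    nonlinearTerm a b c (bessel p) = nonlinearL2 a b c p := by
  rw [nonlinearTerm, laplacian, fourierMultiplier_congr_ae _ (cubic_ae_eq a b c p),
    fourierMultiplier_bessel laplacian_bound]
  rfl

lemma nonlinearL2_zero (a b c : ℝ) : nonlinearL2 a b c 0 = 0 := by
  simp [nonlinearL2]

lemma continuous_nonlinearL2 (a b c : ℝ) : Continuous (nonlinearL2 a b c) := by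
  unfold nonlinearL2
  fun_prop

lemma isRealValued_nonlinearL2 (a b c : ℝ) {p : L2} (hp : IsRealValued p) :
    IsRealValued (nonlinearL2 a b c p) := by
  rw [← nonlinearTerm_bessel]
  refine isRealValued_fourierMultiplier (fun k => by rw [freqSq_neg, Complex.conj_ofReal]) ?_
  filter_upwards [isRealValued_bessel hp] with x hx
  obtain ⟨r, hr⟩ : ∃ r : ℝ, bessel p x = r := ⟨(bessel p x).re, Complex.ext (by simp) (by simp [hx])⟩
  rw [hr]
  norm_cast

/-- Telescoping p² - q² and p³ - q³ through the bounded bilinear product gives 2AR and 3A²R², where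
A is the norm of the product. -/
lemma nonlinearL2_lipschitz (a b c R : ℝ) : ∃ L : ℝ, 0 ≤ L ∧ ∀ p q : L2, ‖p‖ ≤ R → ‖q‖ ≤ R →
    ‖nonlinearL2 a b c p - nonlinearL2 a b c q‖ ≤ L * ‖p - q‖ := by
  set A := ‖besselMulCLM‖ with hA
  have hA0 : 0 ≤ A := hA ▸ norm_nonneg besselMulCLM
  have hm : ∀ p q : L2, ‖besselMulCLM p q‖ ≤ A * ‖p‖ * ‖q‖ := besselMulCLM.le_opNorm₂
  rcases lt_or_ge R 0 with hR | hR
  · exact ⟨0, le_rfl, fun p _ hp => absurd ((norm_nonneg p).trans hp) (not_le.2 hR)⟩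
  refine ⟨‖laplacianBessel‖ * (|a| * (3 * A ^ 2 * R ^ 2) + |b| * (2 * A * R) + |c|), by positivity,
    fun p q hp hq => ?_⟩
  have h2 : ‖besselMulCLM p p - besselMulCLM q q‖ ≤ 2 * A * R * ‖p - q‖ := by
    have e : besselMulCLM p p - besselMulCLM q q =
        besselMulCLM (p - q) p + besselMulCLM q (p - q) := by
      simp only [map_sub, sub_apply]
      abel
    rw [e]
    calc _ ≤ A * ‖p - q‖ * ‖p‖ + A * ‖q‖ * ‖p - q‖ := norm_add_le_of_le (hm _ _) (hm _ _)
      _ ≤ A * ‖p - q‖ * R + A * R * ‖p - q‖ := by gcongr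
      _ = _ := by ring
  have h3 : ‖besselMulCLM p (besselMulCLM p p) - besselMulCLM q (besselMulCLM q q)‖ ≤
      3 * A ^ 2 * R ^ 2 * ‖p - q‖ := by
    have e : besselMulCLM p (besselMulCLM p p) - besselMulCLM q (besselMulCLM q q) =
        besselMulCLM (p - q) (besselMulCLM p p) +
          besselMulCLM q (besselMulCLM p p - besselMulCLM q q) := by
      simp only [map_sub, sub_apply]
      abel
    rw [e]
    calc _ ≤ A * ‖p - q‖ * ‖besselMulCLM p p‖ +
          A * ‖q‖ * ‖besselMulCLM p p - besselMulCLM q q‖ := norm_add_le_of_le (hm _ _) (hm _ _)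
      _ ≤ A * ‖p - q‖ * (A * R * R) + A * R * (2 * A * R * ‖p - q‖) := by
          have : ‖besselMulCLM p p‖ ≤ A * R * R := (hm p p).trans (by gcongr)
          gcongr
      _ = _ := by ring
  rw [nonlinearL2, nonlinearL2, ← map_sub, mul_assoc]
  refine (laplacianBessel.le_opNorm _).trans ?_
  gcongr
  rw [add_sub_add_comm, add_sub_add_comm, ← smul_sub, ← smul_sub, ← smul_sub]
  calc _ ≤ |a| * (3 * A ^ 2 * R ^ 2 * ‖p - q‖) + |b| * (2 * A * R * ‖p - q‖) + |c| * ‖p - q‖ := by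
        refine norm_add_le_of_le (norm_add_le_of_le ?_ ?_) ?_ <;>
          rw [norm_smul, Complex.norm_real, Real.norm_eq_abs] <;> gcongr
    _ = _ := by ring

/-! ### The bi-Laplacian semigroup -/

/-- The symbol `e^{-σ (4π²|k|²)²}` of `e^{-σΔ²}`. -/
def decay (σ : ℝ) (k : Freq) : ℝ := Real.exp (-(σ * (4 * Real.pi ^ 2 * freqSq k) ^ 2))

lemma decay_pos (σ : ℝ) (k : Freq) : 0 < decay σ k := Real.exp_pos _

lemma decay_le_one {σ : ℝ} (hσ : 0 ≤ σ) (k : Freq) : decay σ k ≤ 1 := by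
  rw [decay, Real.exp_le_one_iff, neg_nonpos]
  positivity

lemma decay_add (σ τ : ℝ) (k : Freq) : decay (σ + τ) k = decay σ k * decay τ k := by
  rw [decay, decay, decay, ← Real.exp_add]
  ring_nf

lemma decay_zero (k : Freq) : decay 0 k = 1 := by simp [decay]

lemma decay_neg_freq (σ : ℝ) (k : Freq) : decay σ (-k) = decay σ k := by simp [decay, freqSq_neg]

lemma continuous_decay (k : Freq) : Continuous fun σ => decay σ k := by
  unfold decay
  fun_prop

lemma norm_decay (σ : ℝ) (k : Freq) : ‖(decay σ k : ℂ)‖ = decay σ k := by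
  rw [Complex.norm_real, Real.norm_of_nonneg (decay_pos σ k).le]

/-- From (1 + x)² ≤ 2(1 + x²) and 4π² ≥ 1. The summand 1 covers the zero frequency, where the
semigroup does not decay. -/
lemma weight_sq_le (k : Freq) : weight k ^ 2 ≤ 2 * (1 + (4 * Real.pi ^ 2 * freqSq k) ^ 2) := by
  have h0 := freqSq_nonneg k
  have h1 : freqSq k ≤ 4 * Real.pi ^ 2 * freqSq k := by
    have : 1 ≤ 4 * Real.pi ^ 2 := by nlinarith [Real.pi_gt_three]
    nlinarith
  have h2 : freqSq k ^ 2 ≤ (4 * Real.pi ^ 2 * freqSq k) ^ 2 := pow_le_pow_left₀ h0 h1 2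
  unfold weight
  nlinarith [sq_nonneg (freqSq k - 1)]

/-- The smoothing estimate `(1 + |k|²) e^{-σ(4π²|k|²)²} ≲ σ^(-1/2)`. -/
lemma weight_mul_decay_le {σ T : ℝ} (hσ : 0 < σ) (hT : σ ≤ T) (k : Freq) :
    weight k * decay σ k ≤ 2 * Real.exp T * σ ^ (-(1 / 2) : ℝ) := by
  have hw := weight_pos k
  have hd := decay_pos σ k
  refine (pow_le_pow_iff_left₀ (by positivity) (by positivity) two_ne_zero).1 ?_
  have e1 : (σ ^ (-(1 / 2) : ℝ)) ^ 2 = σ⁻¹ := by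
    rw [← Real.rpow_natCast, ← Real.rpow_mul hσ.le, ← Real.rpow_neg_one]
    norm_num
  rw [mul_pow, mul_pow (2 * Real.exp T), e1, ← div_eq_mul_inv, le_div_iff₀ hσ]
  set m := (4 * Real.pi ^ 2 * freqSq k) ^ 2 with hm
  have hm0 : 0 ≤ m := by positivity
  -- The decay factor equals e^{-y} e^σ, and y e^{-y} ≤ 1. Adding 1 to m for the zero frequency is
  -- what costs the factor e^σ ≤ e^T.
  set y := σ * (1 + m) with hy
  have hy0 : 0 ≤ y := by positivity
  have h1 : y * Real.exp (-y) ≤ 1 := by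
    rw [Real.exp_neg, ← div_eq_mul_inv, div_le_one (Real.exp_pos _)]
    linarith [Real.add_one_le_exp y]
  have e2 : decay σ k = Real.exp (-y) * Real.exp σ := by
    rw [decay, ← hm, ← Real.exp_add, hy]
    ring_nf
  have h3 : Real.exp (-y) ≤ 1 := Real.exp_le_one_iff.2 (by linarith)
  have h4 : Real.exp σ ≤ Real.exp T := Real.exp_le_exp.2 hT
  calc weight k ^ 2 * decay σ k ^ 2 * σ
      ≤ 2 * (1 + m) * decay σ k ^ 2 * σ := by gcongr; exact weight_sq_le k
    _ = 2 * (y * Real.exp (-y)) * Real.exp (-y) * Real.exp σ ^ 2 := by rw [e2, hy]; ring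
    _ ≤ 2 * 1 * 1 * Real.exp T ^ 2 := by gcongr
    _ ≤ (2 * Real.exp T) ^ 2 := by nlinarith [sq_nonneg (Real.exp T)]

lemma heat_bound (σ : ℝ) : ∃ C : ℝ, ∀ k, ‖(decay (max σ 0) k : ℂ)‖ ≤ C :=
  ⟨1, fun k => by rw [norm_decay]; exact decay_le_one (le_max_right _ _) k⟩

/-- The semigroup `e^{-σΔ²}` on `L²`, extended by the identity to `σ < 0`. -/
def heat (σ : ℝ) : L2 →L[ℂ] L2 := multCLM (fun k => (decay (max σ 0) k : ℂ)) (heat_bound σ)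

lemma biheat_eq_heat {σ : ℝ} (hσ : 0 ≤ σ) (f : L2) : biheat σ f = heat σ f := by
  rw [heat, multCLM_apply, max_eq_left hσ]
  rfl

lemma coeff_heat {σ : ℝ} (hσ : 0 ≤ σ) (f : L2) (k : Freq) :
    coeffCLM k (heat σ f) = decay σ k * coeffCLM k f := by
  rw [heat, coeff_multCLM, max_eq_left hσ]

lemma coeff_biheat {σ : ℝ} (hσ : 0 ≤ σ) (f : L2) (k : Freq) :
    coeffCLM k (biheat σ f) = decay σ k * coeffCLM k f := by
  rw [biheat_eq_heat hσ, coeff_heat hσ]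

lemma norm_heat_le (σ : ℝ) (f : L2) : ‖heat σ f‖ ≤ ‖f‖ := by
  have h := norm_fourierMultiplier_le (m := fun k => (decay (max σ 0) k : ℂ)) (C := 1)
    (fun k => by rw [norm_decay]; exact decay_le_one (le_max_right _ _) k) f
  rwa [one_mul] at h

lemma isRealValued_heat (σ : ℝ) {f : L2} (hf : IsRealValued f) : IsRealValued (heat σ f) :=
  isRealValued_multCLM _ (fun k => by rw [decay_neg_freq, Complex.conj_ofReal]) hf

lemma continuousOn_heat (f : L2) : ContinuousOn (fun σ => heat σ f) (Ici 0) := by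
  intro σ₀ hσ₀
  refine tendsto_of_coeff 2 f ?_ fun k => ?_
  · filter_upwards [self_mem_nhdsWithin] with σ hσ k
    rw [coeff_heat hσ, coeff_heat hσ₀, ← sub_mul, norm_mul]
    gcongr
    refine (norm_sub_le _ _).trans ?_
    rw [norm_decay, norm_decay]
    linarith [decay_le_one hσ k, decay_le_one hσ₀ k]
  · refine Tendsto.congr' (f₁ := fun σ => (decay σ k : ℂ) * coeffCLM k f) ?_ ?_
    · filter_upwards [self_mem_nhdsWithin] with σ hσ
      rw [coeff_heat hσ]
    · rw [coeff_heat hσ₀]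
      exact (((Complex.continuous_ofReal.comp (continuous_decay k)).mul
        continuous_const).tendsto σ₀).mono_left nhdsWithin_le_nhds

lemma norm_weight_mul_decay (σ : ℝ) (k : Freq) :
    ‖((weight k * decay σ k : ℝ) : ℂ)‖ = weight k * decay σ k := by
  rw [Complex.norm_real, Real.norm_of_nonneg (mul_pos (weight_pos k) (decay_pos σ k)).le]

lemma smoothing_bound {σ : ℝ} (hσ : 0 < σ) :
    ∃ C : ℝ, ∀ k, ‖((weight k * decay σ k : ℝ) : ℂ)‖ ≤ C :=
  ⟨_, fun k => by rw [norm_weight_mul_decay]; exact weight_mul_decay_le hσ le_rfl k⟩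

open Classical in
/-- The operator `(1 + |k|²) e^{-σΔ²}` for `σ > 0`, extended by zero. -/
def smoothing (σ : ℝ) : L2 →L[ℂ] L2 :=
  if hσ : 0 < σ then multCLM (fun k => ((weight k * decay σ k : ℝ) : ℂ)) (smoothing_bound hσ) else 0

lemma coeff_smoothing {σ : ℝ} (hσ : 0 < σ) (f : L2) (k : Freq) :
    coeffCLM k (smoothing σ f) = ((weight k * decay σ k : ℝ) : ℂ) * coeffCLM k f := by
  rw [smoothing, dif_pos hσ, coeff_multCLM]

lemma bessel_smoothing {σ : ℝ} (hσ : 0 < σ) (f : L2) : bessel (smoothing σ f) = heat σ f :=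
  ext_coeff fun k => by
    rw [coeff_bessel, coeff_smoothing hσ, coeff_heat hσ.le, ← mul_assoc, ← Complex.ofReal_mul,
      ← mul_assoc, inv_mul_cancel₀ (weight_pos k).ne', one_mul]

lemma isRealValued_smoothing (σ : ℝ) {f : L2} (hf : IsRealValued f) :
    IsRealValued (smoothing σ f) := by
  rw [smoothing]
  split_ifs with h
  · exact isRealValued_multCLM _
      (fun k => by rw [decay_neg_freq, weight_neg, Complex.conj_ofReal]) hf
  · exact isRealValued_iff_coeff.2 fun k => by simp

lemma norm_smoothing_apply_le {σ T : ℝ} (hσ : 0 < σ) (hT : σ ≤ T) (f : L2) :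
    ‖smoothing σ f‖ ≤ 2 * Real.exp T * σ ^ (-(1 / 2) : ℝ) * ‖f‖ := by
  rw [smoothing, dif_pos hσ]
  exact norm_fourierMultiplier_le
    (fun k => by rw [norm_weight_mul_decay]; exact weight_mul_decay_le hσ hT k) f

lemma continuousOn_smoothing (f : L2) : ContinuousOn (fun σ => smoothing σ f) (Ioi 0) := by
  intro σ₀ hσ₀
  have hσ₀' : 0 < σ₀ := hσ₀
  refine ContinuousAt.continuousWithinAt ?_
  -- On (σ₀/2, 2σ₀) one constant bounds all the symbols; the outer 2 comes from the triangle
  -- inequality.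
  refine tendsto_of_coeff (2 * (2 * Real.exp (2 * σ₀) * (σ₀ / 2) ^ (-(1 / 2) : ℝ))) f ?_ fun k => ?_
  · have h : ∀ σ ∈ Ioo (σ₀ / 2) (2 * σ₀), ∀ k, weight k * decay σ k ≤
        2 * Real.exp (2 * σ₀) * (σ₀ / 2) ^ (-(1 / 2) : ℝ) := fun σ hσ k => by
      refine (weight_mul_decay_le (by linarith [hσ.1]) hσ.2.le k).trans ?_
      have := Real.rpow_le_rpow_of_nonpos (half_pos hσ₀') hσ.1.le
        (by norm_num : (-(1 / 2) : ℝ) ≤ 0)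
      gcongr
    filter_upwards [Ioo_mem_nhds (half_lt_self hσ₀') (by linarith : σ₀ < 2 * σ₀)] with σ hσ k
    rw [coeff_smoothing (by linarith [hσ.1]), coeff_smoothing hσ₀, ← sub_mul, norm_mul]
    gcongr
    refine (norm_sub_le _ _).trans ?_
    rw [norm_weight_mul_decay, norm_weight_mul_decay]
    linarith [h σ hσ k, h σ₀ ⟨half_lt_self hσ₀', by linarith⟩ k]
  · refine Tendsto.congr' (f₁ := fun σ => ((weight k * decay σ k : ℝ) : ℂ) * coeffCLM k f) ?_ ?_
    · filter_upwards [Ioi_mem_nhds hσ₀'] with σ hσ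
      rw [coeff_smoothing hσ]
    · rw [coeff_smoothing hσ₀]
      exact ((Complex.continuous_ofReal.comp (continuous_const.mul (continuous_decay k))).mul
        continuous_const).tendsto σ₀

/-- The smoothing estimate at σ = τε, with σ ≤ ε because τ ≤ 1. -/
lemma isSingularKernel_smoothing {ε : ℝ} (hε : 0 < ε) :
    IsSingularKernel (fun τ => (smoothing (τ * ε)).restrictScalars ℝ)
      (2 * Real.exp ε * ε ^ (-(1 / 2) : ℝ)) where
  nonneg := by positivity
  eq_zero τ hτ := by
    rw [smoothing, dif_neg (not_lt.2 (mul_nonpos_of_nonpos_of_nonneg hτ hε.le))]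
    rfl
  bound τ hτ hτ1 := by
    refine ContinuousLinearMap.opNorm_le_bound _ (by positivity) fun f => ?_
    refine (norm_smoothing_apply_le (mul_pos hτ hε) (mul_le_of_le_one_left hε.le hτ1) f).trans_eq ?_
    rw [Real.mul_rpow hτ.le hε.le]
    ring
  continuousOn f := (continuousOn_smoothing f).comp (f := fun τ => τ * ε) (by fun_prop)
    fun τ hτ => mul_pos hτ hε

/-! ### The forcing along a path in `H²` -/

/-- The forcing `Δ(a f³ + b f² + c f) - v(s) · ∇f` at `f = (1 + |k|²)⁻¹ p`. -/
def forcing (a b c : ℝ) (v : ℝ → Fin 2 → L2) (s : ℝ) (p : L2) : L2 :=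
  nonlinearL2 a b c p - advectionL2 (v s) p

section Flow

variable {v : ℝ → Fin 2 → L2}

lemma IsDivFreeFlow.ae_memLp_top (hv : IsDivFreeFlow v) :
    ∀ᵐ t ∂(volume.restrict (Ici (0 : ℝ))), ∀ i, MemLp (v t i) ∞ (volume : Measure Torus) := by
  obtain ⟨M, hM⟩ := hv.bounded
  filter_upwards [hM] with t ht i
  exact ⟨(Lp.memLp (v t i)).1, (ht i).1.trans_lt ENNReal.coe_lt_top⟩

lemma IsDivFreeFlow.aestronglyMeasurable_advectionL2 (hv : IsDivFreeFlow v) {s : Set ℝ}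
    (hs : s ⊆ Ici 0) {p : ℝ → L2} (hp : AEStronglyMeasurable p (volume.restrict s)) :
    AEStronglyMeasurable (fun t => advectionL2 (v t) (p t)) (volume.restrict s) :=
  CahnHilliard.aestronglyMeasurable_advectionL2
    (fun i => (hv.aestronglyMeasurable i).mono_measure (Measure.restrict_mono_set _ hs)) hp
    (ae_restrict_of_ae_restrict_of_subset hs hv.ae_memLp_top)

lemma IsDivFreeFlow.advectionL2_lipschitz (hv : IsDivFreeFlow v) :
    ∃ L : ℝ, 0 ≤ L ∧ ∀ᵐ s ∂(volume.restrict (Ici (0 : ℝ))), ∀ p q,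
      ‖advectionL2 (v s) p - advectionL2 (v s) q‖ ≤ L * ‖p - q‖ := by
  obtain ⟨M, hM⟩ := hv.bounded
  exact ⟨M * ∑ i, ‖derivBessel i‖, by positivity,
    hM.mono fun s hs p q => norm_advectionL2_sub_le (fun i => (hs i).1) p q⟩

lemma forcing_zero (a b c : ℝ) (v : ℝ → Fin 2 → L2) (s : ℝ) : forcing a b c v s 0 = 0 := by
  rw [forcing, nonlinearL2_zero, advectionL2_zero, sub_zero]

lemma IsDivFreeFlow.aestronglyMeasurable_forcing (hv : IsDivFreeFlow v) (a b c : ℝ) {s : Set ℝ}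
    (hs : s ⊆ Ici 0) {p : ℝ → L2} (hp : AEStronglyMeasurable p (volume.restrict s)) :
    AEStronglyMeasurable (fun t => forcing a b c v t (p t)) (volume.restrict s) :=
  ((continuous_nonlinearL2 a b c).comp_aestronglyMeasurable hp).sub
    (hv.aestronglyMeasurable_advectionL2 hs hp)

lemma IsDivFreeFlow.forcing_lipschitz (hv : IsDivFreeFlow v) (a b c R : ℝ) :
    ∃ L : ℝ, 0 ≤ L ∧ ∀ᵐ s ∂(volume.restrict (Ici (0 : ℝ))), ∀ p q, ‖p‖ ≤ R → ‖q‖ ≤ R →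
      ‖forcing a b c v s p - forcing a b c v s q‖ ≤ L * ‖p - q‖ := by
  obtain ⟨L₁, h₁, hL₁⟩ := nonlinearL2_lipschitz a b c R
  obtain ⟨L₂, h₂, hL₂⟩ := hv.advectionL2_lipschitz
  refine ⟨L₁ + L₂, by positivity, hL₂.mono fun s hs p q hp hq => ?_⟩
  rw [forcing, forcing, sub_sub_sub_comm, add_mul]
  exact norm_sub_le_of_le (hL₁ p q hp hq) (hs p q)

lemma IsDivFreeFlow.isRealValued_forcing (hv : IsDivFreeFlow v) (a b c : ℝ) :
    ∀ᵐ s ∂(volume.restrict (Ici (0 : ℝ))), ∀ p, IsRealValued p →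
      IsRealValued (forcing a b c v s p) := by
  filter_upwards [hv.isRealValued, hv.ae_memLp_top] with s h1 h2 p hp
  exact (isRealValued_nonlinearL2 a b c hp).sub (isRealValued_advectionL2 h2 h1 hp)

lemma exists_norm_le_of_continuousOn_Icc {p : ℝ → L2} {T : ℝ}
    (hp : ContinuousOn p (Icc 0 T)) : ∃ R : ℝ, 0 ≤ R ∧ ∀ s ∈ Icc 0 T, ‖p s‖ ≤ R := by
  obtain ⟨R, hR⟩ := isCompact_Icc.exists_bound_of_continuousOn hp
  exact ⟨max R 0, le_max_right _ _, fun s hs => (hR s hs).trans (le_max_left _ _)⟩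

lemma nonlinearL2_bounded (a b c : ℝ) {T : ℝ} {p : ℝ → L2} (hp : ContinuousOn p (Icc 0 T)) :
    ∃ B : ℝ, ∀ᵐ s ∂(volume.restrict (Icc 0 T)), ‖nonlinearL2 a b c (p s)‖ ≤ B := by
  obtain ⟨B, hB⟩ := isCompact_Icc.exists_bound_of_continuousOn
    ((continuous_nonlinearL2 a b c).comp_continuousOn hp)
  exact ⟨B, ae_restrict_of_forall_mem measurableSet_Icc hB⟩

lemma IsDivFreeFlow.advectionL2_bounded (hv : IsDivFreeFlow v) {T : ℝ} {p : ℝ → L2}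
    (hp : ContinuousOn p (Icc 0 T)) :
    ∃ B : ℝ, ∀ᵐ s ∂(volume.restrict (Icc 0 T)), ‖advectionL2 (v s) (p s)‖ ≤ B := by
  obtain ⟨R, hR0, hR⟩ := exists_norm_le_of_continuousOn_Icc hp
  obtain ⟨L, hL0, hL⟩ := hv.advectionL2_lipschitz
  refine ⟨L * R, ?_⟩
  filter_upwards [ae_restrict_of_ae_restrict_of_subset Icc_subset_Ici_self hL,
    ae_restrict_mem measurableSet_Icc] with s h1 h2
  have := h1 (p s) 0
  rw [advectionL2_zero, sub_zero, sub_zero] at this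
  exact this.trans (mul_le_mul_of_nonneg_left (hR s h2) hL0)

lemma IsDivFreeFlow.forcing_bounded (hv : IsDivFreeFlow v) (a b c : ℝ) {T : ℝ} {p : ℝ → L2}
    (hp : ContinuousOn p (Icc 0 T)) :
    ∃ B : ℝ, ∀ᵐ s ∂(volume.restrict (Icc 0 T)), ‖forcing a b c v s (p s)‖ ≤ B := by
  obtain ⟨B₁, h₁⟩ := nonlinearL2_bounded a b c hp
  obtain ⟨B₂, h₂⟩ := hv.advectionL2_bounded hp
  exact ⟨B₁ + B₂, by filter_upwards [h₁, h₂] with s using norm_sub_le_of_le⟩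

end Flow

/-! ### Duhamel integrals -/

lemma aestronglyMeasurable_decay_mul_coeff {μ : Measure ℝ} {F : ℝ → L2}
    (hm : AEStronglyMeasurable F μ) (ε t : ℝ) (k : Freq) :
    AEStronglyMeasurable (fun s => (decay ((t - s) * ε) k : ℂ) * coeffCLM k (F s)) μ := by
  have h : Continuous fun s => (decay ((t - s) * ε) k : ℂ) :=
    Complex.continuous_ofReal.comp ((continuous_decay k).comp (by fun_prop))
  exact h.aestronglyMeasurable.mul ((coeffCLM k).continuous.comp_aestronglyMeasurable hm)

lemma intervalIntegrable_decay_mul_coeff {F : ℝ → L2} {T B : ℝ}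
    (hm : AEStronglyMeasurable F (volume.restrict (Icc 0 T)))
    (hb : ∀ᵐ s ∂(volume.restrict (Icc 0 T)), ‖F s‖ ≤ B) {ε : ℝ} (hε : 0 < ε) {x y t : ℝ}
    (hx : 0 ≤ x) (hxy : x ≤ y) (hyt : y ≤ t) (hyT : y ≤ T) (k : Freq) :
    IntervalIntegrable (fun s => (decay ((t - s) * ε) k : ℂ) * coeffCLM k (F s)) volume x y := by
  rw [intervalIntegrable_iff_integrableOn_Ioc_of_le hxy]
  have hsub : Ioc x y ⊆ Icc 0 T := fun s hs => ⟨hx.trans hs.1.le, hs.2.trans hyT⟩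
  refine Integrable.mono' (integrable_const B) (aestronglyMeasurable_decay_mul_coeff
    (hm.mono_measure (Measure.restrict_mono_set _ hsub)) ε t k) ?_
  filter_upwards [ae_restrict_of_ae_restrict_of_subset hsub hb, ae_restrict_mem measurableSet_Ioc]
    with s h1 h2
  rw [norm_mul, norm_decay]
  calc _ ≤ 1 * ‖F s‖ := by
        have := decay_le_one (mul_nonneg (by linarith [h2.2] : 0 ≤ t - s) hε.le) k
        gcongr
        exact norm_coeffCLM_le k _
    _ ≤ B := by rwa [one_mul]

/-- Duhamel integrals of bounded `L²`-valued functions converge in `H²` and can be computed on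
Fourier coefficients. -/
lemma duhamel_integral {ε : ℝ} (hε : 0 < ε) {t B : ℝ} (ht : 0 ≤ t) {F g : ℝ → L2}
    (hm : AEStronglyMeasurable F (volume.restrict (Icc 0 t)))
    (hb : ∀ᵐ s ∂(volume.restrict (Icc 0 t)), ‖F s‖ ≤ B)
    (hg : ∀ᵐ s ∂(volume.restrict (Icc 0 t)), s ≤ t → g s = biheat ((t - s) * ε) (F s)) :
    BochnerIntegrableH2 g t ∧ ∀ k, coeffCLM k (∫ s in (0 : ℝ)..t, g s) =
      ∫ s in (0 : ℝ)..t, (decay ((t - s) * ε) k : ℂ) * coeffCLM k (F s) := by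
  have hsub : Ioc 0 t ⊆ Icc 0 t := Ioc_subset_Icc_self
  have hc : ∀ k, (fun s => coeffCLM k (g s)) =ᵐ[volume.restrict (Ioc 0 t)]
      fun s => (decay ((t - s) * ε) k : ℂ) * coeffCLM k (F s) := fun k => by
    filter_upwards [ae_restrict_of_ae_restrict_of_subset hsub hg,
      ae_restrict_mem measurableSet_Ioc] with s h1 h2
    rw [h1 h2.2, coeff_biheat (mul_nonneg (by linarith [h2.2]) hε.le)]
  have hgm : AEStronglyMeasurable g (volume.restrict (Ioc 0 t)) :=
    aestronglyMeasurable_of_coeff fun k => (aestronglyMeasurable_decay_mul_coeff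
      (hm.mono_measure (Measure.restrict_mono_set _ hsub)) ε t k).congr (hc k).symm
  have hi : IntervalIntegrable g volume 0 t := by
    rw [intervalIntegrable_iff_integrableOn_Ioc_of_le ht]
    refine Integrable.mono' (integrable_const B) hgm ?_
    filter_upwards [ae_restrict_of_ae_restrict_of_subset hsub hg,
      ae_restrict_of_ae_restrict_of_subset hsub hb,
      ae_restrict_mem measurableSet_Ioc] with s h1 h2 h3
    rw [h1 h3.2, biheat_eq_heat (mul_nonneg (by linarith [h3.2]) hε.le)]
    exact (norm_heat_le _ _).trans h2
  refine ⟨⟨hi, ?_⟩, fun k => ?_⟩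
  -- The smoothing estimate bounds the H² norm of the integrand by this function, integrable since
  -- -1/2 > -1.
  · have hrp : IntervalIntegrable (fun s => 2 * Real.exp (t * ε) * B * ε ^ (-(1 / 2) : ℝ) *
        (t - s) ^ (-(1 / 2) : ℝ)) volume 0 t := by
      have h := (intervalIntegral.intervalIntegrable_rpow' (a := t) (b := 0) (r := -(1 / 2))
        (by norm_num)).comp_sub_left t
      simp only [sub_self, sub_zero] at h
      exact h.const_mul _
    rw [intervalIntegrable_iff_integrableOn_Ioo_of_le ht] at hrp
    refine lt_of_le_of_lt (lintegral_mono_ae ?_) hrp.lintegral_lt_top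
    have hsub' : Ioo 0 t ⊆ Icc 0 t := Ioo_subset_Icc_self
    filter_upwards [ae_restrict_of_ae_restrict_of_subset hsub' hg,
      ae_restrict_of_ae_restrict_of_subset hsub' hb,
      ae_restrict_mem measurableSet_Ioo] with s h1 h2 h3
    have hts : 0 < t - s := by linarith [h3.2]
    have hσ : 0 < (t - s) * ε := mul_pos hts hε
    rw [h1 h3.2.le, biheat_eq_heat hσ.le, ← bessel_smoothing hσ, sobolevNorm_bessel, ← ofReal_norm]
    refine ENNReal.ofReal_le_ofReal ?_
    have hle : (t - s) * ε ≤ t * ε := by nlinarith [h3.1]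
    calc _ ≤ 2 * Real.exp (t * ε) * ((t - s) * ε) ^ (-(1 / 2) : ℝ) * ‖F s‖ :=
          norm_smoothing_apply_le hσ hle _
      _ ≤ 2 * Real.exp (t * ε) * ((t - s) * ε) ^ (-(1 / 2) : ℝ) * B := by gcongr
      _ = _ := by
          rw [Real.mul_rpow hts.le hε.le]
          ring
  · rw [← ContinuousLinearMap.intervalIntegral_comp_comm _ hi,
      intervalIntegral.integral_of_le ht, intervalIntegral.integral_of_le ht]
    exact integral_congr_ae (hc k)

/-! ### Maximal regularity -/

/-- Young's convolution inequality `L¹ * L² ⊆ L²` on the line. -/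
lemma lintegral_sq_conv_le {κ φ : ℝ → ℝ≥0∞} (hκ : Measurable κ) (hφ : AEMeasurable φ) :
    ∫⁻ t, (∫⁻ s, κ (t - s) * φ s) ^ 2 ≤ (∫⁻ τ, κ τ) ^ 2 * ∫⁻ s, φ s ^ 2 := by
  -- A measurable representative changes neither side and makes the double integrand jointly
  -- measurable for Tonelli.
  wlog hφm : Measurable φ generalizing φ
  · have h := this (hφ.measurable_mk.aemeasurable) hφ.measurable_mk
    have e1 : ∀ t, ∫⁻ s, κ (t - s) * hφ.mk φ s = ∫⁻ s, κ (t - s) * φ s := fun t =>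
      lintegral_congr_ae (hφ.ae_eq_mk.mono fun s hs => by simp only [hs])
    have e2 : ∫⁻ s, hφ.mk φ s ^ 2 = ∫⁻ s, φ s ^ 2 :=
      lintegral_congr_ae (hφ.ae_eq_mk.mono fun s hs => by simp only [hs])
    simpa only [e1, e2] using h
  have hκt : ∀ t, Measurable fun s => κ (t - s) := fun t => hκ.comp (by fun_prop)
  calc ∫⁻ t, (∫⁻ s, κ (t - s) * φ s) ^ 2
      ≤ ∫⁻ t, (∫⁻ s, κ (t - s)) * ∫⁻ s, κ (t - s) * φ s ^ 2 :=
        lintegral_mono fun t => sq_lintegral_mul_le (hκt t).aemeasurable hφ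
    _ = (∫⁻ τ, κ τ) * ∫⁻ t, ∫⁻ s, κ (t - s) * φ s ^ 2 := by
        simp_rw [lintegral_sub_left_eq_self κ]
        rw [lintegral_const_mul]
        exact Measurable.lintegral_prod_right'
          (f := fun z : ℝ × ℝ => κ (z.1 - z.2) * φ z.2 ^ 2) (by fun_prop)
    _ = (∫⁻ τ, κ τ) * ∫⁻ s, ∫⁻ t, κ (t - s) * φ s ^ 2 := by
        rw [lintegral_lintegral_swap]
        exact Measurable.aemeasurable (by unfold Function.uncurry; fun_prop)
    _ = _ := by
        have : ∀ s, ∫⁻ t, κ (t - s) * φ s ^ 2 = (∫⁻ τ, κ τ) * φ s ^ 2 := fun s => by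
          rw [lintegral_mul_const _ (by fun_prop), lintegral_sub_right_eq_self κ]
        simp_rw [this]
        rw [lintegral_const_mul _ (by fun_prop), pow_two, mul_assoc]

/-- The decay factor restricted to `[0, T]`. -/
def cutDecay (ε T : ℝ) (k : Freq) : ℝ → ℝ≥0∞ :=
  (Icc 0 T).indicator fun τ => ENNReal.ofReal (decay (τ * ε) k)

lemma measurable_cutDecay (ε T : ℝ) (k : Freq) : Measurable (cutDecay ε T k) := by
  refine Measurable.indicator ?_ measurableSet_Icc
  exact (((continuous_decay k).comp (by fun_prop)).measurable).ennreal_ofReal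

lemma cutDecay_of_mem {ε T τ : ℝ} (hτ : τ ∈ Icc 0 T) (k : Freq) :
    cutDecay ε T k τ = ENNReal.ofReal (decay (τ * ε) k) := indicator_of_mem hτ _

/-- The gain of four derivatives, uniform in k. With m the symbol of Δ², the integral I of the decay
satisfies I ≤ T trivially and εmI ≤ 1 by explicit integration, while the squared weight is at most
2(1 + m). -/
lemma weight_sq_mul_lintegral_cutDecay_le {ε T : ℝ} (hε : 0 < ε) (hT : 0 ≤ T) (k : Freq) :
    ENNReal.ofReal (weight k ^ 2) * ∫⁻ τ, cutDecay ε T k τ ≤ ENNReal.ofReal (2 * (T + 1 / ε)) := by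
  have hcont : Continuous fun τ => decay (τ * ε) k := (continuous_decay k).comp (by fun_prop)
  have e : ∫⁻ τ, cutDecay ε T k τ = ENNReal.ofReal (∫ τ in (0 : ℝ)..T, decay (τ * ε) k) := by
    rw [cutDecay, lintegral_indicator measurableSet_Icc, intervalIntegral.integral_of_le hT,
      ← integral_Icc_eq_integral_Ioc, ofReal_integral_eq_lintegral_ofReal
        (hcont.continuousOn.integrableOn_compact isCompact_Icc)
        (.of_forall fun τ => (decay_pos _ k).le)]
  rw [e, ← ENNReal.ofReal_mul (by positivity)]
  refine ENNReal.ofReal_le_ofReal ?_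
  set m := (4 * Real.pi ^ 2 * freqSq k) ^ 2 with hm
  have hm0 : 0 ≤ m := by positivity
  set I := ∫ τ in (0 : ℝ)..T, decay (τ * ε) k with hI
  have hI0 : 0 ≤ I := intervalIntegral.integral_nonneg hT fun τ _ => (decay_pos _ k).le
  have hI1 : I ≤ T := by
    have h := intervalIntegral.integral_mono_on hT (hcont.intervalIntegrable (μ := volume) 0 T)
      (intervalIntegrable_const (c := (1 : ℝ)) (μ := volume))
      fun τ hτ => decay_le_one (mul_nonneg hτ.1 hε.le) k
    simpa using h
  have hI2 : ε * m * I ≤ 1 := by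
    have hd : ∀ τ ∈ uIcc 0 T,
        HasDerivAt (fun τ => -decay (τ * ε) k) (ε * m * decay (τ * ε) k) τ := fun τ _ => by
      have h : HasDerivAt (fun τ : ℝ => -(τ * ε * m)) (-(1 * ε * m)) τ :=
        (((hasDerivAt_id τ).mul_const ε).mul_const m).neg
      have h2 := h.exp.neg
      refine h2.congr_deriv ?_
      rw [decay, ← hm]
      ring
    have h := intervalIntegral.integral_eq_sub_of_hasDerivAt hd
      ((hcont.const_mul _).intervalIntegrable 0 T)
    rw [intervalIntegral.integral_const_mul, ← hI] at h
    rw [h, zero_mul, decay_zero]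
    linarith [decay_pos (T * ε) k]
  have hI3 : m * I ≤ 1 / ε := by
    rw [le_div_iff₀ hε]
    linarith
  calc weight k ^ 2 * I ≤ 2 * (1 + m) * I := by gcongr; exact weight_sq_le k
    _ = 2 * (I + m * I) := by ring
    _ ≤ _ := by gcongr

lemma sobolevNorm_four (f : L2) :
    sobolevNorm 4 f ^ 2 = ∑' k, ENNReal.ofReal (weight k ^ 2) ^ 2 * ‖coeffCLM k f‖ₑ ^ 2 := by
  rw [sobolevNorm, ← ENNReal.rpow_natCast, ← ENNReal.rpow_mul]
  norm_num
  refine tsum_congr fun k => ?_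
  rw [← ENNReal.ofReal_pow (sq_nonneg _), ← pow_mul, coeffCLM_apply, weight]

/-- Maximal regularity: solutions of the linear equation with `H²` data and bounded `L²` forcing
belong to `L²(0, T; H⁴)`. -/
lemma lintegral_sobolevNorm_four_lt_top {ε T B : ℝ} (hε : 0 < ε) (hT : 0 ≤ T) {u F : ℝ → L2}
    (p₀ : L2) (hu : AEStronglyMeasurable u (volume.restrict (Ioc 0 T)))
    (hm : AEStronglyMeasurable F (volume.restrict (Icc 0 T)))
    (hb : ∀ᵐ s ∂(volume.restrict (Icc 0 T)), ‖F s‖ ≤ B)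
    (h : ∀ t ∈ Icc 0 T, ∀ k, coeffCLM k (u t) = decay (t * ε) k * coeffCLM k (bessel p₀) +
      ∫ s in (0 : ℝ)..t, (decay ((t - s) * ε) k : ℂ) * coeffCLM k (F s)) :
    ∫⁻ t in Ioc 0 T, sobolevNorm 4 (u t) ^ 2 < ∞ := by
  set D := ENNReal.ofReal (2 * (T + 1 / ε)) with hD
  set W : Freq → ℝ≥0∞ := fun k => ENNReal.ofReal (weight k ^ 2) with hW
  set φ : Freq → ℝ → ℝ≥0∞ := fun k => (Ioc 0 T).indicator fun s => ‖coeffCLM k (F s)‖ₑ with hφ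
  have hm' : AEStronglyMeasurable F (volume.restrict (Ioc 0 T)) :=
    hm.mono_measure (Measure.restrict_mono_set _ Ioc_subset_Icc_self)
  have hcm : ∀ k, AEMeasurable (fun s => ‖coeffCLM k (F s)‖ₑ) (volume.restrict (Ioc 0 T)) :=
    fun k => ((coeffCLM k).continuous.comp_aestronglyMeasurable hm').enorm
  have hφm : ∀ k, AEMeasurable (φ k) := fun k =>
    (aemeasurable_indicator_iff measurableSet_Ioc).2 (hcm k)
  -- Extending decay and forcing by zero turns the Duhamel integral into a convolution on the line.
  -- In the linear term one of the two decay factors is bounded by 1.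
  have hpt : ∀ k, ∀ t ∈ Ioc 0 T, ‖coeffCLM k (u t)‖ₑ ^ 2 ≤
      2 * (cutDecay ε T k t * ‖coeffCLM k (bessel p₀)‖ₑ ^ 2 +
        (∫⁻ s, cutDecay ε T k (t - s) * φ k s) ^ 2) := fun k t ht => by
    have ht' : t ∈ Icc 0 T := Ioc_subset_Icc_self ht
    have hen : ∀ σ, ‖(decay σ k : ℂ)‖ₑ = ENNReal.ofReal (decay σ k) := fun σ => by
      rw [← ofReal_norm, norm_decay]
    have h1 : ‖(decay (t * ε) k : ℂ) * coeffCLM k (bessel p₀)‖ₑ ^ 2 ≤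
        cutDecay ε T k t * ‖coeffCLM k (bessel p₀)‖ₑ ^ 2 := by
      rw [enorm_mul, mul_pow, hen, cutDecay_of_mem ht']
      gcongr
      rw [pow_two]
      refine mul_le_of_le_one_right' ?_
      rw [ENNReal.ofReal_le_one]
      exact decay_le_one (mul_nonneg ht.1.le hε.le) k
    have h2 : ‖∫ s in (0 : ℝ)..t, (decay ((t - s) * ε) k : ℂ) * coeffCLM k (F s)‖ₑ ≤
        ∫⁻ s, cutDecay ε T k (t - s) * φ k s := by
      rw [intervalIntegral.integral_of_le ht.1.le]
      refine (enorm_integral_le_lintegral_enorm _).trans ?_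
      refine le_trans ?_ (setLIntegral_le_lintegral (Ioc 0 t) _)
      refine setLIntegral_mono' measurableSet_Ioc fun s hs => ?_
      rw [enorm_mul, hen, cutDecay_of_mem ⟨by linarith [hs.2], by linarith [hs.1, ht.2]⟩, hφ]
      simp only
      rw [indicator_of_mem (show s ∈ Ioc 0 T from ⟨hs.1, hs.2.trans ht.2⟩)]
    rw [h t ht' k]
    refine (pow_le_pow_left' (enorm_add_le _ _) 2).trans ((ennreal_add_sq_le _ _).trans ?_)
    gcongr
  have hk : ∀ k, ∫⁻ t in Ioc 0 T, W k ^ 2 * ‖coeffCLM k (u t)‖ₑ ^ 2 ≤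
      2 * (D * ‖coeffCLM k p₀‖ₑ ^ 2 +
        D ^ 2 * ∫⁻ s in Ioc 0 T, ‖coeffCLM k (F s)‖ₑ ^ 2) := fun k => by
    have hI := weight_sq_mul_lintegral_cutDecay_le hε hT k
    -- H² data absorb one of the two factors W; the time integral of the decay absorbs the other.
    have h0 : W k ^ 2 * ‖coeffCLM k (bessel p₀)‖ₑ ^ 2 = W k * ‖coeffCLM k p₀‖ₑ ^ 2 := by
      simp only [hW]
      rw [enorm_coeff_bessel, pow_two (weight k), ENNReal.ofReal_mul (weight_pos k).le]
      calc _ = (ENNReal.ofReal (weight k) * ENNReal.ofReal (weight k)⁻¹) ^ 2 *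
            (ENNReal.ofReal (weight k) * ENNReal.ofReal (weight k) * ‖coeffCLM k p₀‖ₑ ^ 2) := by
            ring
        _ = _ := by rw [ofReal_weight_mul_inv, one_pow, one_mul]
    have hφ2 : ∫⁻ s, φ k s ^ 2 = ∫⁻ s in Ioc 0 T, ‖coeffCLM k (F s)‖ₑ ^ 2 := by
      rw [← lintegral_indicator measurableSet_Ioc]
      refine lintegral_congr fun s => ?_
      simp only [hφ]
      by_cases hs : s ∈ Ioc 0 T
      · rw [indicator_of_mem hs, indicator_of_mem hs]
      · rw [indicator_of_notMem hs, indicator_of_notMem hs, zero_pow two_ne_zero]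
    have hcut := measurable_cutDecay ε T k
    calc _ ≤ ∫⁻ t, W k ^ 2 * (2 * (cutDecay ε T k t * ‖coeffCLM k (bessel p₀)‖ₑ ^ 2 +
          (∫⁻ s, cutDecay ε T k (t - s) * φ k s) ^ 2)) := by
          refine le_trans (setLIntegral_mono' measurableSet_Ioc fun t ht => ?_)
            (setLIntegral_le_lintegral (Ioc 0 T) _)
          exact mul_le_mul_right (hpt k t ht) _
      _ = W k ^ 2 * (2 * ((∫⁻ t, cutDecay ε T k t) * ‖coeffCLM k (bessel p₀)‖ₑ ^ 2 +
          ∫⁻ t, (∫⁻ s, cutDecay ε T k (t - s) * φ k s) ^ 2)) := by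
          rw [lintegral_const_mul' _ _ (ENNReal.pow_ne_top ENNReal.ofReal_ne_top),
            lintegral_const_mul' _ _ (by norm_num), lintegral_add_left (by fun_prop),
            lintegral_mul_const _ hcut]
      _ ≤ W k ^ 2 * (2 * ((∫⁻ t, cutDecay ε T k t) * ‖coeffCLM k (bessel p₀)‖ₑ ^ 2 +
          (∫⁻ t, cutDecay ε T k t) ^ 2 * ∫⁻ s in Ioc 0 T, ‖coeffCLM k (F s)‖ₑ ^ 2)) := by
          rw [← hφ2]
          gcongr
          exact lintegral_sq_conv_le hcut (hφm k)
      _ = 2 * ((∫⁻ t, cutDecay ε T k t) * (W k ^ 2 * ‖coeffCLM k (bessel p₀)‖ₑ ^ 2) +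
          (W k * ∫⁻ t, cutDecay ε T k t) ^ 2 * ∫⁻ s in Ioc 0 T, ‖coeffCLM k (F s)‖ₑ ^ 2) := by
          ring
      _ = 2 * ((W k * ∫⁻ t, cutDecay ε T k t) * ‖coeffCLM k p₀‖ₑ ^ 2 +
          (W k * ∫⁻ t, cutDecay ε T k t) ^ 2 * ∫⁻ s in Ioc 0 T, ‖coeffCLM k (F s)‖ₑ ^ 2) := by
          rw [h0]
          ring
      _ ≤ _ := by gcongr
  have hFb : ∫⁻ s in Ioc 0 T, ‖F s‖ₑ ^ 2 ≤ ENNReal.ofReal B ^ 2 * ENNReal.ofReal T := by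
    calc _ ≤ ∫⁻ _ in Ioc 0 T, ENNReal.ofReal B ^ 2 := by
          refine lintegral_mono_ae ?_
          filter_upwards [ae_restrict_of_ae_restrict_of_subset Ioc_subset_Icc_self hb] with s hs
          rw [← ofReal_norm]
          gcongr
      _ = _ := by
        rw [setLIntegral_const, Real.volume_Ioc, sub_zero]
  calc ∫⁻ t in Ioc 0 T, sobolevNorm 4 (u t) ^ 2
      = ∑' k, ∫⁻ t in Ioc 0 T, W k ^ 2 * ‖coeffCLM k (u t)‖ₑ ^ 2 := by
        simp_rw [sobolevNorm_four]
        exact lintegral_tsum fun k =>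
          (((coeffCLM k).continuous.comp_aestronglyMeasurable hu).enorm.pow_const 2).const_mul _
    _ ≤ ∑' k, 2 * (D * ‖coeffCLM k p₀‖ₑ ^ 2 +
        D ^ 2 * ∫⁻ s in Ioc 0 T, ‖coeffCLM k (F s)‖ₑ ^ 2) := ENNReal.tsum_le_tsum hk
    _ = 2 * (D * ‖p₀‖ₑ ^ 2 + D ^ 2 * ∫⁻ s in Ioc 0 T, ‖F s‖ₑ ^ 2) := by
        rw [ENNReal.tsum_mul_left, ENNReal.tsum_add, ENNReal.tsum_mul_left, ENNReal.tsum_mul_left,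
          tsum_enorm_sq_coeff, ← lintegral_tsum fun k => (hcm k).pow_const 2]
        simp_rw [tsum_enorm_sq_coeff]
    _ ≤ 2 * (D * ‖p₀‖ₑ ^ 2 + D ^ 2 * (ENNReal.ofReal B ^ 2 * ENNReal.ofReal T)) := by gcongr
    _ < ∞ := by
        have h1 : ‖p₀‖ₑ < ∞ := enorm_lt_top
        have h2 : D < ∞ := ENNReal.ofReal_lt_top
        have h3 : ENNReal.ofReal B < ∞ := ENNReal.ofReal_lt_top
        have h4 : ENNReal.ofReal T < ∞ := ENNReal.ofReal_lt_top
        exact ENNReal.mul_lt_top (by norm_num) (ENNReal.add_lt_top.2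
          ⟨ENNReal.mul_lt_top h2 (ENNReal.pow_lt_top h1), ENNReal.mul_lt_top
            (ENNReal.pow_lt_top h2) (ENNReal.mul_lt_top (ENNReal.pow_lt_top h3) h4)⟩)

/-! ### Mild solutions on the Fourier side -/

variable {ε a b c : ℝ} {v : ℝ → Fin 2 → L2}

/-- The path `(1 + |k|²)⁻¹ p` in `H²` satisfies Duhamel's formula on `[0, T]` for every Fourier
coefficient. -/
structure IsFourierSolution (ε a b c : ℝ) (v : ℝ → Fin 2 → L2) (u₀ : L2) (T : ℝ) (p : ℝ → L2) :
    Prop where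
  continuousOn : ContinuousOn p (Icc 0 T)
  isRealValued : ∀ t ∈ Icc 0 T, IsRealValued (p t)
  duhamel : ∀ t ∈ Icc 0 T, ∀ k, coeffCLM k (bessel (p t)) = decay (t * ε) k * coeffCLM k u₀ +
    ∫ s in (0 : ℝ)..t, (decay ((t - s) * ε) k : ℂ) * coeffCLM k (forcing a b c v s (p s))

/-- The two Duhamel integrals in the definition of a mild solution. -/
lemma IsDivFreeFlow.duhamel_terms (hv : IsDivFreeFlow v) (hε : 0 < ε) (a b c : ℝ) {t : ℝ}
    (ht : 0 ≤ t) {p u : ℝ → L2} (hp : ContinuousOn p (Icc 0 t))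
    (hu : ∀ s ∈ Icc 0 t, u s = bessel (p s)) :
    BochnerIntegrableH2 (fun s => biheat ((t - s) * ε) (nonlinearTerm a b c (u s))) t ∧
    BochnerIntegrableH2 (fun s => biheat ((t - s) * ε) (advection (v s) (u s))) t ∧
    ∀ k, coeffCLM k ((∫ s in (0 : ℝ)..t, biheat ((t - s) * ε) (nonlinearTerm a b c (u s))) -
        ∫ s in (0 : ℝ)..t, biheat ((t - s) * ε) (advection (v s) (u s))) =
      ∫ s in (0 : ℝ)..t, (decay ((t - s) * ε) k : ℂ) * coeffCLM k (forcing a b c v s (p s)) := by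
  have hpm : AEStronglyMeasurable p (volume.restrict (Icc 0 t)) :=
    hp.aestronglyMeasurable measurableSet_Icc
  obtain ⟨B₁, hB₁⟩ := nonlinearL2_bounded a b c hp
  obtain ⟨B₂, hB₂⟩ := hv.advectionL2_bounded hp
  have hm₁ := (continuous_nonlinearL2 a b c).comp_aestronglyMeasurable hpm
  have hm₂ := hv.aestronglyMeasurable_advectionL2 Icc_subset_Ici_self hpm
  have h₁ := duhamel_integral hε ht hm₁ hB₁
    (g := fun s => biheat ((t - s) * ε) (nonlinearTerm a b c (u s))) (by
      filter_upwards [ae_restrict_mem measurableSet_Icc] with s hs _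
      rw [hu s hs, nonlinearTerm_bessel])
  have h₂ := duhamel_integral hε ht hm₂ hB₂
    (g := fun s => biheat ((t - s) * ε) (advection (v s) (u s))) (by
      filter_upwards [ae_restrict_mem measurableSet_Icc,
        ae_restrict_of_ae_restrict_of_subset Icc_subset_Ici_self hv.ae_memLp_top] with s hs h _
      rw [hu s hs]
      exact fourierMultiplier_congr_ae _ (coeFn_advectionL2 h (p s)).symm)
  refine ⟨h₁.1, h₂.1, fun k => ?_⟩
  rw [map_sub, h₁.2, h₂.2, ← intervalIntegral.integral_sub
    (intervalIntegrable_decay_mul_coeff hm₁ hB₁ hε le_rfl ht le_rfl le_rfl k)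
    (intervalIntegrable_decay_mul_coeff hm₂ hB₂ hε le_rfl ht le_rfl le_rfl k)]
  simp only [forcing, map_sub, mul_sub]

/-- As `bessel` is an isometry onto H², continuity of u in H² is continuity of p in L². -/
lemma IsMildSolution.exists_isFourierSolution (hv : IsDivFreeFlow v) (hε : 0 < ε) {u₀ : L2}
    {T : ℝ} {u : ℝ → L2} (hu : IsMildSolution ε a b c v u₀ T u) :
    ∃ p : ℝ → L2, (∀ t ∈ Icc 0 T, u t = bessel (p t)) ∧ IsFourierSolution ε a b c v u₀ T p := by
  have h : ∀ t, ∃ p, t ∈ Icc 0 T → bessel p = u t := fun t => by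
    by_cases ht : t ∈ Icc 0 T
    · exact (exists_bessel_eq (hu.memSobolev t ht)).imp fun p hp _ => hp
    · exact ⟨0, fun h => absurd h ht⟩
  choose p hp using h
  have hup : ∀ t ∈ Icc 0 T, u t = bessel (p t) := fun t ht => (hp t ht).symm
  have hc : ContinuousOn p (Icc 0 T) := fun t ht => by
    refine tendsto_iff_edist_tendsto_0.2 ((hu.continuous t ht).congr' ?_)
    filter_upwards [self_mem_nhdsWithin] with r hr
    rw [hup r hr, hup t ht, ← map_sub, sobolevNorm_bessel, edist_eq_enorm_sub]
  refine ⟨p, hup, hc, fun t ht => isRealValued_of_bessel (hup t ht ▸ hu.isRealValued t ht),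
    fun t ht k => ?_⟩
  have hsub : Icc 0 t ⊆ Icc 0 T := Icc_subset_Icc_right ht.2
  rw [← hup t ht, hu.duhamel t ht, add_sub_assoc, map_add,
    (hv.duhamel_terms hε a b c ht.1 (hc.mono hsub) fun s hs => hup s (hsub hs)).2.2 k,
    coeff_biheat (mul_nonneg ht.1 hε.le)]

/-- A continuous path has bounded forcing, so the L²(0, T; H⁴) bound comes for free from maximal
regularity. -/
lemma IsFourierSolution.isMildSolution (hv : IsDivFreeFlow v) (hε : 0 < ε) {p₀ : L2} {T : ℝ}
    (hT : 0 ≤ T) {p : ℝ → L2} (hp : IsFourierSolution ε a b c v (bessel p₀) T p) :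
    IsMildSolution ε a b c v (bessel p₀) T fun t => bessel (p t) := by
  have hterms : ∀ t ∈ Icc 0 T, _ := fun t ht => hv.duhamel_terms hε a b c ht.1
    (hp.continuousOn.mono (Icc_subset_Icc_right ht.2)) (u := fun t => bessel (p t)) fun s _ => rfl
  have hpm : AEStronglyMeasurable p (volume.restrict (Icc 0 T)) :=
    hp.continuousOn.aestronglyMeasurable measurableSet_Icc
  refine ⟨fun t ht => isRealValued_bessel (hp.isRealValued t ht), fun t _ => ?_, fun t ht => ?_, ?_,
    fun t ht => (hterms t ht).1, fun t ht => (hterms t ht).2.1, fun t ht => ?_⟩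
  · rw [MemSobolev, sobolevNorm_bessel]
    exact enorm_lt_top
  · simp_rw [← map_sub, sobolevNorm_bessel, ← edist_eq_enorm_sub]
    exact tendsto_iff_edist_tendsto_0.1 (hp.continuousOn t ht)
  · obtain ⟨B, hB⟩ := hv.forcing_bounded a b c hp.continuousOn
    exact lintegral_sobolevNorm_four_lt_top hε hT p₀
      (bessel.continuous.comp_aestronglyMeasurable
        (hpm.mono_measure (Measure.restrict_mono_set _ Ioc_subset_Icc_self)))
      (hv.aestronglyMeasurable_forcing a b c Icc_subset_Ici_self hpm) hB hp.duhamel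
  · refine ext_coeff fun k => ?_
    rw [hp.duhamel t ht k, add_sub_assoc, map_add, (hterms t ht).2.2 k,
      coeff_biheat (mul_nonneg ht.1 hε.le)]

/-! ### Local existence and continuation -/

/-- `p` solves the equation on `[t₁, t₁ + h]` with data `p₁` at time `t₁`, on the Fourier side. -/
structure IsFourierSolutionFrom (ε a b c : ℝ) (v : ℝ → Fin 2 → L2) (p₁ : L2) (t₁ h : ℝ)
    (p : ℝ → L2) : Prop where
  continuous : Continuous p
  isRealValued : ∀ t, IsRealValued (p t)
  duhamel : ∀ t ∈ Icc t₁ (t₁ + h), ∀ k, coeffCLM k (bessel (p t)) =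
    decay ((t - t₁) * ε) k * coeffCLM k (bessel p₁) +
    ∫ s in t₁..t, (decay ((t - s) * ε) k : ℂ) * coeffCLM k (forcing a b c v s (p s))

/-- The abstract theorem with kernel (1 + |k|²)e^{-τεΔ²} and real-valued functions as the invariant
closed set. That h precedes t₁ in the quantifiers is what the blow-up argument rests on. -/
lemma exists_isFourierSolutionFrom (hv : IsDivFreeFlow v) (hε : 0 < ε) (a b c R : ℝ) :
    ∃ h : ℝ, 0 < h ∧ ∀ t₁, 0 ≤ t₁ → ∀ p₁, IsRealValued p₁ → ‖p₁‖ ≤ R →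
      ∃ p, IsFourierSolutionFrom ε a b c v p₁ t₁ h p := by
  obtain ⟨h, hh, H⟩ := exists_local_solution (E := L2) (isSingularKernel_smoothing hε)
    (S := fun τ => (heat (τ * ε)).restrictScalars ℝ)
    (fun τ _ => ContinuousLinearMap.opNorm_le_bound _ zero_le_one fun f => by
      rw [one_mul]; exact norm_heat_le _ f)
    (fun f => (continuousOn_heat f).comp (f := fun τ => τ * ε) (by fun_prop)
      fun τ hτ => mul_nonneg hτ hε.le)
    (G := forcing a b c v)
    (fun w hw => hv.aestronglyMeasurable_forcing a b c subset_rfl hw.aestronglyMeasurable)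
    (hv.forcing_lipschitz a b c) (forcing_zero a b c v) (P := {f | IsRealValued f})
    isClosed_isRealValued (isRealValued_iff_coeff.2 fun k => by simp)
    (fun x hx y hy => IsRealValued.add hx hy)
    (fun g x y hxy hg => isRealValued_intervalIntegral hxy hg)
    (fun τ x hx => isRealValued_heat _ hx) (fun τ x hx => isRealValued_smoothing _ hx)
    (hv.isRealValued_forcing a b c) R
  refine ⟨h, hh, fun t₁ ht₁ p₁ hp₁ hR => ?_⟩
  obtain ⟨p, hc, hr, hd⟩ := H t₁ ht₁ p₁ hp₁ hR
  refine ⟨p, hc, hr, fun t ht k => ?_⟩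
  obtain ⟨hi, he⟩ := hd t ht
  have h1 := congrArg (fun f => coeffCLM k (bessel f)) he
  simp only [map_add, ContinuousLinearMap.coe_restrictScalars'] at h1 hi
  have h3 : coeffCLM k (bessel (heat ((t - t₁) * ε) p₁)) =
      decay ((t - t₁) * ε) k * coeffCLM k (bessel p₁) := by
    rw [coeff_bessel, coeff_heat (mul_nonneg (by linarith [ht.1]) hε.le), coeff_bessel]
    ring
  rw [h1, h3]
  refine congrArg _ ?_
  have h2 := ((coeffCLM k).comp bessel).intervalIntegral_comp_comm hi
  simp only [ContinuousLinearMap.comp_apply] at h2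
  rw [← h2]
  refine intervalIntegral.integral_congr_ae_restrict ?_
  rw [uIoc_of_le ht.1]
  -- The point s = t is dropped because `smoothing 0` is 0 by convention, whereas e^{-0Δ²} is the
  -- identity.
  filter_upwards [ae_restrict_mem measurableSet_Ioc, ae_restrict_of_ae (Measure.ae_ne volume t)]
    with s hs hst
  have hσ : 0 < (t - s) * ε := mul_pos (sub_pos.2 (lt_of_le_of_ne hs.2 hst)) hε
  rw [bessel_smoothing hσ, coeff_heat hσ.le]

/-- Concatenation of solutions. -/
lemma IsFourierSolution.extend (hv : IsDivFreeFlow v) (hε : 0 < ε) {u₀ : L2} {t₁ h : ℝ}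
    (ht₁ : 0 ≤ t₁) (hh : 0 < h) {p q : ℝ → L2} (hp : IsFourierSolution ε a b c v u₀ t₁ p)
    (hq : IsFourierSolutionFrom ε a b c v (p t₁) t₁ h q) :
    IsFourierSolution ε a b c v u₀ (t₁ + h) fun t => if t ≤ t₁ then p t else q t := by
  -- At t₁ the Duhamel integral is empty, so the two pieces agree there.
  have hpq : q t₁ = p t₁ := bessel_injective <| ext_coeff fun k => by
    rw [hq.duhamel t₁ ⟨le_rfl, by linarith⟩ k]
    simp [decay_zero]
  set z : ℝ → L2 := fun t => if t ≤ t₁ then p t else q t with hz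
  have hzp : ∀ t ≤ t₁, z t = p t := fun t ht => if_pos ht
  have hzq : ∀ t, t₁ ≤ t → z t = q t := fun t ht => by
    rcases ht.eq_or_lt with rfl | ht
    · rw [hzp _ le_rfl, hpq]
    · exact if_neg (not_le.2 ht)
  have hzc : ContinuousOn z (Icc 0 (t₁ + h)) := by
    rw [← Icc_union_Icc_eq_Icc ht₁ (by linarith : t₁ ≤ t₁ + h)]
    refine ContinuousOn.union_of_isClosed ?_ ?_ isClosed_Icc isClosed_Icc
    · exact hp.continuousOn.congr fun t ht => hzp t ht.2
    · exact hq.continuous.continuousOn.congr fun t ht => hzq t ht.1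
  refine ⟨hzc, fun t ht => ?_, fun t ht k => ?_⟩
  · rcases le_total t t₁ with h' | h'
    · rw [hzp t h']
      exact hp.isRealValued t ⟨ht.1, h'⟩
    · rw [hzq t h']
      exact hq.isRealValued t
  rcases le_total t t₁ with h' | h'
  · rw [hzp t h', hp.duhamel t ⟨ht.1, h'⟩ k]
    refine congrArg _ (intervalIntegral.integral_congr fun s hs => ?_)
    rw [uIcc_of_le ht.1] at hs
    simp only [hzp s (hs.2.trans h')]
  have hzm : AEStronglyMeasurable z (volume.restrict (Icc 0 (t₁ + h))) :=
    hzc.aestronglyMeasurable measurableSet_Icc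
  obtain ⟨B, hB⟩ := hv.forcing_bounded a b c hzc
  have hm := hv.aestronglyMeasurable_forcing a b c Icc_subset_Ici_self hzm
  rw [← intervalIntegral.integral_add_adjacent_intervals
    (intervalIntegrable_decay_mul_coeff hm hB hε le_rfl ht₁ h' (h'.trans ht.2) k)
    (intervalIntegrable_decay_mul_coeff hm hB hε ht₁ h' le_rfl ht.2 k)]
  -- Semigroup property: the history before t₁ is the Duhamel term at t₁ propagated over t - t₁.
  have e1 : ∫ s in (0 : ℝ)..t₁, (decay ((t - s) * ε) k : ℂ) * coeffCLM k (forcing a b c v s (z s)) =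
      decay ((t - t₁) * ε) k * ∫ s in (0 : ℝ)..t₁,
        (decay ((t₁ - s) * ε) k : ℂ) * coeffCLM k (forcing a b c v s (p s)) := by
    rw [← intervalIntegral.integral_const_mul]
    refine intervalIntegral.integral_congr fun s hs => ?_
    rw [uIcc_of_le ht₁] at hs
    simp only [hzp s hs.2]
    rw [← mul_assoc, ← Complex.ofReal_mul, ← decay_add]
    ring_nf
  have e2 : ∫ s in t₁..t, (decay ((t - s) * ε) k : ℂ) * coeffCLM k (forcing a b c v s (z s)) =
      ∫ s in t₁..t, (decay ((t - s) * ε) k : ℂ) * coeffCLM k (forcing a b c v s (q s)) := by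
    refine intervalIntegral.integral_congr fun s hs => ?_
    rw [uIcc_of_le h'] at hs
    simp only [hzq s hs.1]
  rw [e1, e2, hzq t h', hq.duhamel t ⟨h', ht.2⟩ k, hp.duhamel t₁ ⟨ht₁, le_rfl⟩ k, mul_add,
    ← mul_assoc, ← Complex.ofReal_mul, ← decay_add, add_assoc]
  ring_nf

lemma IsFourierSolutionFrom.isFourierSolution {p₀ : L2} {h : ℝ} {p : ℝ → L2}
    (hp : IsFourierSolutionFrom ε a b c v p₀ 0 h p) :
    IsFourierSolution ε a b c v (bessel p₀) h p where
  continuousOn := hp.continuous.continuousOn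
  isRealValued t _ := hp.isRealValued t
  duhamel t ht k := by simpa using hp.duhamel t (by simpa using ht) k

lemma IsFourierSolution.le_maximalTime (hv : IsDivFreeFlow v) (hε : 0 < ε) {p₀ : L2} {T : ℝ}
    (hT : 0 < T) {p : ℝ → L2} (hp : IsFourierSolution ε a b c v (bessel p₀) T p) :
    ENNReal.ofReal T ≤ maximalTime ε a b c v (bessel p₀) :=
  le_sSup ⟨T, hT, rfl, _, hp.isMildSolution hv hε hT.le⟩

end CahnHilliard

end

/-! ### The blow-up alternative -/

open CahnHilliard in
theorem corollary2p7 (ε a b c : ℝ) (hε : 0 < ε)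
    (v : ℝ → Fin 2 → L2) (hv : IsDivFreeFlow v)
    (u₀ : L2) (hu₀ : IsRealValued u₀) (hu₀' : MemSobolev 2 u₀)
    (u : ℝ → L2)
    (hu : ∀ T : ℝ, 0 < T → ENNReal.ofReal T < maximalTime ε a b c v u₀ →
      IsMildSolution ε a b c v u₀ T u) :
    0 < maximalTime ε a b c v u₀ ∧
      (maximalTime ε a b c v u₀ = ∞ ∨
        limsup (fun t => sobolevNorm 2 (u t)) (𝓝[<] (maximalTime ε a b c v u₀).toReal) = ∞) := by
  obtain ⟨p₀, rfl⟩ := exists_bessel_eq hu₀'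
  have hpos : 0 < maximalTime ε a b c v (bessel p₀) := by
    obtain ⟨h, hh, H⟩ := exists_isFourierSolutionFrom hv hε a b c ‖p₀‖
    obtain ⟨p, hp⟩ := H 0 le_rfl p₀ (isRealValued_of_bessel hu₀) le_rfl
    exact (ENNReal.ofReal_pos.2 hh).trans_le (hp.isFourierSolution.le_maximalTime hv hε hh)
  refine ⟨hpos, ?_⟩
  by_contra! hcon
  obtain ⟨hfin, hlim⟩ := hcon
  set τ := maximalTime ε a b c v (bessel p₀) with hτ
  have hτ0 : 0 < τ.toReal := ENNReal.toReal_pos hpos.ne' hfin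
  -- Any finite R above the limsup bounds the H² norm near τ; the lifespan h is fixed from R before
  -- t₁ is chosen.
  obtain ⟨R, hR1, hR2⟩ := ENNReal.lt_iff_exists_nnreal_btwn.1 (lt_top_iff_ne_top.2 hlim)
  obtain ⟨h, hh, H⟩ := exists_isFourierSolutionFrom hv hε a b c R
  have hev : ∀ᶠ t in 𝓝[<] τ.toReal, sobolevNorm 2 (u t) < R ∧
      t ∈ Ioo (max 0 (τ.toReal - h)) τ.toReal :=
    (eventually_lt_of_limsup_lt hR1).and
      (Ioo_mem_nhdsLT (max_lt hτ0 (by linarith)))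
  obtain ⟨t₁, hb, ht₁, ht₁'⟩ := hev.exists
  obtain ⟨h0, hth⟩ := max_lt_iff.1 ht₁
  have hlt : ENNReal.ofReal t₁ < τ := (ENNReal.ofReal_lt_iff_lt_toReal h0.le hfin).2 ht₁'
  obtain ⟨p, hup, hp⟩ := (hu t₁ h0 hlt).exists_isFourierSolution hv hε
  have hmem : t₁ ∈ Icc 0 t₁ := ⟨h0.le, le_rfl⟩
  rw [hup t₁ hmem, sobolevNorm_bessel] at hb
  have hnorm : ‖p t₁‖ ≤ R := by
    have : ‖p t₁‖₊ < R := by exact_mod_cast hb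
    exact_mod_cast this.le
  obtain ⟨q, hq⟩ := H t₁ h0.le (p t₁) (hp.isRealValued t₁ hmem) hnorm
  -- The glued solution lives up to t₁ + h, which exceeds τ by the choice of t₁.
  have hle := (hp.extend hv hε h0.le hh hq).le_maximalTime hv hε (by linarith)
  rw [← hτ] at hle
  have := (ENNReal.ofReal_le_iff_le_toReal hfin).1 hle
  linarith
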